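/- Let $\mathfrak g$ be a finite-dimensional complex simple Lie algebra, $\mathfrak b$ a Borel subalgebra, $\mathfrak h\subseteq\mathfrak b$ a Cartan subalgebra of $\mathfrak g$, $\Phi_0$ the root system of $(\mathfrak g,\mathfrak h)$ with root spaces $\mathfrak g_\alpha$, and $\Phi_0^+=\{\alpha\in\Phi_0\mid \mathfrak g_\alpha\subseteq\mathfrak b\}$, with $\Phi_0^-=-\Phi_0^+$. Let $V_0$ be the real span of $\Phi_0$ with a Weyl-group-invariant inner product, and let $V=V_0\oplus\mathbb R\delta$, with the bilinear form extended so that $\delta$ is orthogonal to $V$. Put $$\Phi^+=\{\alpha+n\delta\mid \alpha\in\Phi_0^+,\ n\ge 0\}\sqcup\{-\alpha+n\delta\mid\alpha\in\Phi_0^+,\ n\ge 1\},\qquad \Phi^-=-\Phi^+,\qquad \Phi=\Phi^+\sqcup\Phi^-,$$ and let $W$ be the affine Weyl group, that is, the subgroup of $GL(V)$ generated by the reflections in the roots of $\Phi$. For $w\in W$ let $N(w)=\Phi^+\cap w(\Phi^-)$. For $X\subseteq V$ let $\operatorname{cone}_\Phi(X)$ be the set of elements of $\Phi$ that are linear combinations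 of elements of $X$ with nonnegative real coefficients. A root $\beta\in\Phi^+$ is small if there is no $\alpha\in\Phi^+$ with $\alpha\neq\beta$ such that, for all $w\in W$, $\beta\in N(w)$ implies $\alpha\in N(w)$. Let $\Sigma$ be the set of small roots. An element $w\in W$ is low if $N(w)=\operatorname{cone}_\Phi(\Sigma\cap N(w))$. Let $\mathcal J$ be an ad-nilpotent ideal of $\mathfrak b$, i.e. an ideal of $\mathfrak b$ contained in $[\mathfrak b,\mathfrak b]$, and let $\Phi_{\mathcal J}=\{\alpha\in\Phi_0^+\mid\mathfrak g_\alpha\subseteq\mathcal J\}$, so that $\mathcal J=\bigoplus_{\alpha\in\Phi_{\mathcal J}}\mathfrak g_\alpha$. Put $\Phi_{\mathcal J}^1=\Phi_{\mathcal J}$, $\Phi_{\mathcal J}^{k}=\{\alpha+\beta\mid\alpha\in\Phi_{\mathcal J}^{k-1},\ \beta\in\Phi_{\mathcal J},\ \alpha+\beta\in\Phi_0^+\}$ for $k\ge 2$, and $\mathbb L_{\mathcal J}=\bigcup_{k\ge1}\{k\delta-\beta\mid\beta\in\Phi_{\mathcal J}^k\}$. Then there is a unique element $w_{\mathcal J}\in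 W$ with $N(w_{\mathcal J})=\mathbb L_{\mathcal J}$, and $$N(w_{\mathcal J})=\operatorname{cone}_\Phi(\{\delta-\alpha\mid\alpha\in\Phi_{\mathcal J}\}).$$ Moreover $\{\delta-\alpha\mid\alpha\in\Phi_{\mathcal J}\}\subseteq\Sigma$, and $w_{\mathcal J}$ is a low element of $W$. -/

import Mathlib

noncomputable section

namespace AffineRoot

section General

variable {ι M N : Type*} [AddCommGroup M] [Module ℝ M] [AddCommGroup N] [Module ℝ N]
  {P : RootPairing ι ℝ M N}

/-- The positive roots `Φ₀⁺` of the finite root system `Φ₀`, relative to a base. -/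
def finitePos (b : P.Base) : Set M := {x | ∃ i, b.IsPos i ∧ P.root i = x}

/-- The imaginary root `δ` in `V = V₀ ⊕ ℝδ`, where `V` is modelled as `M × ℝ`. -/
def delta (M : Type*) [AddCommGroup M] : M × ℝ := (0, 1)

/-- The inclusion of `V₀` in `V = V₀ ⊕ ℝδ`. -/
def emb (x : M) : M × ℝ := (x, 0)

/-- The positive affine roots `Φ⁺ = (Φ₀⁺ + ℕδ) ⊔ (Φ₀⁻ + ℕ*δ)`. -/
def affinePos (b : P.Base) : Set (M × ℝ) :=
  {x | ∃ α ∈ finitePos b, ∃ n : ℕ, x = emb α + (n : ℝ) • delta M} ∪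
  {x | ∃ α ∈ finitePos b, ∃ n : ℕ, 1 ≤ n ∧ x = emb (-α) + (n : ℝ) • delta M}

/-- The negative affine roots `Φ⁻ = -Φ⁺`. -/
def affineNeg (b : P.Base) : Set (M × ℝ) := {x | -x ∈ affinePos b}

/-- The affine root system `Φ = Φ⁺ ⊔ Φ⁻`. -/
def affineRoots (b : P.Base) : Set (M × ℝ) := affinePos b ∪ affineNeg b

/-- The coroot of `α + kδ`, as a linear form on `V`. Since `δ` spans the radical of the bilinear
form on `V`, this is `v ↦ 2⟨v, α⟩ / ⟨α, α⟩`, that is `v ↦ ⟨v₀, α^∨⟩` with `v₀` the `V₀`-component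
of `v`. -/
def affineCoroot (P : RootPairing ι ℝ M N) (i : ι) : Module.Dual ℝ (M × ℝ) :=
  (P.coroot' i).comp (LinearMap.fst ℝ M ℝ)

theorem affineCoroot_root (P : RootPairing ι ℝ M N) (i : ι) (k : ℤ) :
    affineCoroot P i (emb (P.root i) + (k : ℝ) • delta M) = 2 := by
  simp [affineCoroot, emb, delta]

/-- The reflection of `V` in the affine root `α + kδ`. -/
def affineReflection (P : RootPairing ι ℝ M N) (i : ι) (k : ℤ) : (M × ℝ) ≃ₗ[ℝ] (M × ℝ) :=
  Module.reflection (affineCoroot_root P i k)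

/-- The affine Weyl group `W`, acting on `V`: the group generated by the reflections in the
affine roots `α + kδ`. -/
def affineWeylGroup (P : RootPairing ι ℝ M N) : Subgroup ((M × ℝ) ≃ₗ[ℝ] (M × ℝ)) :=
  Subgroup.closure {r | ∃ (i : ι) (k : ℤ), r = affineReflection P i k}

/-- The inversion set `N(w) = Φ⁺ ∩ w(Φ⁻)`. -/
def inversionSet (b : P.Base) (w : affineWeylGroup P) : Set (M × ℝ) :=
  affinePos b ∩ w.1 '' affineNeg b

/-- `cone_Φ(X)`: the affine roots that are nonnegative real linear combinations of elements
of `X`. -/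
def coneRoots (b : P.Base) (X : Set (M × ℝ)) : Set (M × ℝ) :=
  (PointedCone.hull ℝ X : Set (M × ℝ)) ∩ affineRoots b

/-- The dominance order on positive affine roots: `α ⪯ β` if every inversion set containing `β`
contains `α`. -/
def Dominance (b : P.Base) (α β : M × ℝ) : Prop :=
  ∀ w : affineWeylGroup P, β ∈ inversionSet b w → α ∈ inversionSet b w

/-- The dominance set `Dom(β) = {α ∈ Φ⁺ | α ≺ β}`. -/
def dominanceSet (b : P.Base) (β : M × ℝ) : Set (M × ℝ) :=
  {α | α ∈ affinePos b ∧ Dominance b α β ∧ α ≠ β}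

/-- The set `Σ` of small roots: the positive affine roots `β` with `|Dom(β)| = 0`. -/
def smallRoots (b : P.Base) : Set (M × ℝ) :=
  {β | β ∈ affinePos b ∧ (dominanceSet b β).encard = 0}

/-- `w` is a low element if `N(w) = cone_Φ(Σ ∩ N(w))`. -/
def IsLow (b : P.Base) (w : affineWeylGroup P) : Prop :=
  inversionSet b w = coneRoots b (smallRoots b ∩ inversionSet b w)

/-- The bracket `[Ψ₁, Ψ₂] = {α₁ + α₂ | αᵢ ∈ Ψᵢ, α₁ + α₂ ∈ Φ₀⁺}`. -/
def rootBracket (b : P.Base) (Ψ₁ Ψ₂ : Set M) : Set M :=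
  {x | x ∈ finitePos b ∧ ∃ α₁ ∈ Ψ₁, ∃ α₂ ∈ Ψ₂, x = α₁ + α₂}

/-- The iterated brackets, with a shift of index: `rootPower b Ψ n` is `Ψ^(n+1)`, where
`Ψ^1 = Ψ` and `Ψ^k = [Ψ^(k-1), Ψ]`. -/
def rootPower (b : P.Base) (Ψ : Set M) : ℕ → Set M
  | 0 => Ψ
  | n + 1 => rootBracket b (rootPower b Ψ n) Ψ

/-- `L_Ψ = ⋃_{k ≥ 1} (kδ - Ψ^k)`. -/
def celliniPapiSet (b : P.Base) (Ψ : Set M) : Set (M × ℝ) :=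
  {x | ∃ n : ℕ, ∃ β ∈ rootPower b Ψ n, x = ((n + 1 : ℕ) : ℝ) • delta M - emb β}

/-- The set `{δ - α | α ∈ Ψ}`. -/
def deltaSub (Ψ : Set M) : Set (M × ℝ) := {x | ∃ α ∈ Ψ, x = delta M - emb α}

end General

section Lie

variable {L : Type*} [LieRing L] [LieAlgebra ℂ L]

/-- A Borel subalgebra: a maximal solvable subalgebra. -/
def IsBorel (B : LieSubalgebra ℂ L) : Prop :=
  Maximal (fun S : LieSubalgebra ℂ L ↦ LieAlgebra.IsSolvable S) B

/-- An ideal of `B` is ad-nilpotent if it is contained in `[B, B]`. -/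
def IsAdNilpotentIdeal {B : LieSubalgebra ℂ L} (J : LieIdeal ℂ B) : Prop :=
  J ≤ ⁅(⊤ : LieIdeal ℂ B), (⊤ : LieIdeal ℂ B)⁆

variable [FiniteDimensional ℂ L] [LieAlgebra.IsSimple ℂ L]
  (H : LieSubalgebra ℂ L) [H.IsCartanSubalgebra]

/-- The real form of the root system of `(L, H)`: it lives on the real span `V₀` of the roots. -/
abbrev realRootSystem :
    RootPairing H.root ℝ
      (Submodule.span ℝ (Set.range (LieAlgebra.IsKilling.rootSystem H).root))
      (Submodule.span ℝ (Set.range (LieAlgebra.IsKilling.rootSystem H).coroot)) :=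
  (LieAlgebra.IsKilling.rootSystem H).restrictScalars ℝ

variable {H}

/-- The base `b` is the simple system determined by the subalgebra `B`: a root is positive
exactly when its root space is contained in `B`. -/
def IsBaseOf (b : (realRootSystem H).Base) (B : LieSubalgebra ℂ L) : Prop :=
  ∀ α : H.root, b.IsPos α ↔ ∀ x ∈ LieAlgebra.rootSpace H α.1, x ∈ B

/-- `Φ_J`: the positive roots whose root space is contained in the ideal `J` of `B`. For an
ad-nilpotent ideal `J`, this is the set of positive roots with `J = ⨁_{α ∈ Φ_J} L_α`. -/
def idealRoots (b : (realRootSystem H).Base) {B : LieSubalgebra ℂ L} (J : LieIdeal ℂ B) :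
    Set (Submodule.span ℝ (Set.range (LieAlgebra.IsKilling.rootSystem H).root)) :=
  {x | ∃ α : H.root, b.IsPos α ∧ (realRootSystem H).root α = x ∧
    ∀ y ∈ LieAlgebra.rootSpace H α.1, ∃ hy : y ∈ B, (⟨y, hy⟩ : B) ∈ J}

end Lie

end AffineRoot

end

/-! Write `Ψ` for the set of roots of the ideal. Since brackets of root spaces fill the root space
of the sum, `Ψ` is stable under adding positive roots. For such a `Ψ` the set `L_Ψ` is finite and
biclosed: it is closed under sums, and so is its complement among the positive roots, multiples of
`δ` included. This reduces to two facts about powers in the finite root system: `Ψ^m + Ψ^n` lies in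
`Ψ^(m+n)` whenever the sum is a root (`IsUpper.add_mem_rootPower`), and if `x`, `y` are positive
with `x + y ∈ Ψ^(m+n)`, then `x ∈ Ψ^m` or `y ∈ Ψ^n` (`IsUpper.mem_or_mem_rootPower`). Both rest on
`add_mem_of_add_add_mem`.

A finite biclosed set `S` is an inversion set: it contains a simple root `a`, the set `s_a(S \ {a})`
is again biclosed, and induction on cardinality applies (`IsBiclosed.exists_inversionSet_eq`).
Uniqueness holds because only the identity of `W` preserves `Φ⁺`.

An element `kδ - β` of `L_Ψ` is a sum of `k` roots `δ - α` with `α ∈ Ψ`, while an inversion set is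
cut out of `Φ` by linear inequalities and so contains the cone roots of its subsets; this gives the
cone formula.

For smallness, a linear form positive on `δ` is negative on only finitely many positive roots, and
these form an inversion set. For each positive `γ ≠ δ - α` some such form is negative on `δ - α` and
nonnegative on `γ`, so `γ` is not dominated by `δ - α`. Lowness then follows from the cone formula.
-/

namespace AffineRoot

open Set

/-! ### Heights and sums of roots in the finite root system. -/

section FiniteRoots

variable {ι M N : Type*} [AddCommGroup M] [Module ℝ M] [AddCommGroup N] [Module ℝ N]
  {P : RootPairing ι ℝ M N}

/-- The height, as a linear form on `V₀`. -/
noncomputable def heightForm [P.IsRootSystem] (b : P.Base) : M →ₗ[ℝ] ℝ :=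
  b.toWeightBasis.constr ℝ fun _ ↦ (1 : ℝ)

theorem heightForm_root [P.IsRootSystem] (b : P.Base) (i : ι) :
    heightForm b (P.root i) = b.height i := by
  obtain ⟨f, -, -, hf⟩ := b.exists_root_eq_sum_int i
  rw [RootPairing.Base.height_eq_sum hf, hf, map_sum, Int.cast_sum]
  refine Finset.sum_congr rfl fun j hj ↦ ?_
  have := b.toWeightBasis.constr_basis ℝ (fun _ ↦ (1 : ℝ)) ⟨j, hj⟩
  rw [RootPairing.Base.toWeightBasis_apply] at this
  rw [map_zsmul, heightForm, this]
  simp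

theorem heightForm_ne_zero [P.IsRootSystem] (b : P.Base) {x : M} (hx : x ∈ range P.root) :
    heightForm b x ≠ 0 := by
  obtain ⟨i, rfl⟩ := hx
  rw [heightForm_root]
  exact_mod_cast b.height_ne_zero i

theorem mem_finitePos_iff [P.IsRootSystem] (b : P.Base) {x : M} :
    x ∈ finitePos b ↔ x ∈ range P.root ∧ 0 < heightForm b x := by
  constructor
  · rintro ⟨i, hi, rfl⟩
    refine ⟨mem_range_self i, ?_⟩
    rw [heightForm_root]
    exact_mod_cast hi
  · rintro ⟨⟨i, rfl⟩, h⟩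
    refine ⟨i, ?_, rfl⟩
    rw [heightForm_root] at h
    exact_mod_cast h

theorem neg_mem_range_root {x : M} (hx : x ∈ range P.root) : -x ∈ range P.root :=
  P.neg_mem_range_root_iff.2 hx

theorem mem_finitePos_or_neg [P.IsRootSystem] (b : P.Base) {x : M} (hx : x ∈ range P.root) :
    x ∈ finitePos b ∨ -x ∈ finitePos b := by
  rw [mem_finitePos_iff, mem_finitePos_iff]
  rcases lt_or_gt_of_ne (heightForm_ne_zero b hx) with h | h
  · exact .inr ⟨neg_mem_range_root hx, by simpa using h⟩
  · exact .inl ⟨hx, h⟩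

theorem add_mem_finitePos [P.IsRootSystem] (b : P.Base) {x y : M} (hx : x ∈ finitePos b)
    (hy : y ∈ finitePos b) (hxy : x + y ∈ range P.root) : x + y ∈ finitePos b := by
  rw [mem_finitePos_iff] at *
  exact ⟨hxy, by rw [map_add]; exact add_pos hx.2 hy.2⟩

/-- Positive roots cannot cancel; this discards the zero alternative in `add_mem_of_add_add_mem`. -/
theorem add_mem_range_root_of_pos [P.IsRootSystem] {b : P.Base} {x y : M}
    (hx : x ∈ finitePos b) (hy : y ∈ finitePos b) (h : x + y ∈ range P.root ∨ x + y = 0) :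
    x + y ∈ range P.root := by
  refine h.resolve_right fun h0 ↦ ?_
  have h1 := ((mem_finitePos_iff b).1 hx).2
  have h2 := ((mem_finitePos_iff b).1 hy).2
  have := congrArg (heightForm b) h0
  rw [map_add, map_zero] at this
  linarith

variable [Finite ι] [P.IsCrystallographic]

theorem pairing_nonpos_comm {i j : ι} : P.pairing i j ≤ 0 ↔ P.pairing j i ≤ 0 := by
  rw [← P.algebraMap_pairingIn ℤ, ← P.algebraMap_pairingIn ℤ]
  have := P.pairingIn_le_zero_iff ℤ (i := i) (j := j)
  simpa using this

theorem root_sub_root_of_pairing_pos {i j : ι} (h : 0 < P.pairing i j) :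
    P.root i - P.root j ∈ range P.root ∨ P.root i - P.root j = 0 := by
  rw [← P.algebraMap_pairingIn ℤ] at h
  by_cases hij : i = j
  · simp [hij]
  · exact .inl (P.root_sub_root_mem_of_pairingIn_pos (by simpa using h) hij)

theorem root_add_root_of_pairing_neg {i j : ι} (h : P.pairing i j < 0) :
    P.root i + P.root j ∈ range P.root ∨ P.root i + P.root j = 0 := by
  rw [← P.algebraMap_pairingIn ℤ] at h
  by_cases hij : P.root i = - P.root j
  · simp [hij]
  · exact .inl (P.root_add_root_mem_of_pairingIn_neg (by simpa using h) hij)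

/-- If `x + y` and `x + y + z` are roots, then one of `x + z`, `y + z` is a root or zero. -/
theorem add_mem_of_add_add_mem {x y z : M} (hx : x ∈ range P.root) (hy : y ∈ range P.root)
    (hz : z ∈ range P.root) (hxy : x + y ∈ range P.root) (hxyz : x + y + z ∈ range P.root) :
    (x + z ∈ range P.root ∨ x + z = 0) ∨ (y + z ∈ range P.root ∨ y + z = 0) := by
  obtain ⟨i, rfl⟩ := hx
  obtain ⟨j, rfl⟩ := hy
  obtain ⟨k, rfl⟩ := hz
  obtain ⟨s, hs⟩ := hxy
  obtain ⟨r, hr⟩ := hxyz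
  -- With `s = x + y` and `r = s + z`, the failure of both alternatives gives `⟨z, s^∨⟩ ≥ 0` and
  -- `⟨r, s^∨⟩ ≤ 0`, whereas `⟨r, s^∨⟩ = 2 + ⟨z, s^∨⟩`.
  by_contra! hcon
  obtain ⟨⟨h1, h1'⟩, h2, h2'⟩ := hcon
  have e1 : 0 ≤ P.pairing i k := by
    by_contra! h
    exact (root_add_root_of_pairing_neg h).elim h1 h1'
  have e2 : 0 ≤ P.pairing j k := by
    by_contra! h
    exact (root_add_root_of_pairing_neg h).elim h2 h2'
  have e3 : P.pairing r i ≤ 0 := by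
    by_contra! h
    have : P.root r - P.root i = P.root j + P.root k := by rw [hr]; abel
    have := root_sub_root_of_pairing_pos h
    simp_all
  have e4 : P.pairing r j ≤ 0 := by
    by_contra! h
    have : P.root r - P.root j = P.root i + P.root k := by rw [hr]; abel
    have := root_sub_root_of_pairing_pos h
    simp_all
  have add (t : ι) : P.pairing s t = P.pairing i t + P.pairing j t := by
    simp only [← P.root_coroot'_eq_pairing, hs, map_add]
  have add' (t : ι) : P.pairing r t = P.pairing s t + P.pairing k t := by
    simp only [← P.root_coroot'_eq_pairing, hr, hs, map_add]
  have e5 : 0 ≤ P.pairing k s := by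
    by_contra! h
    have h' := pairing_nonpos_comm.1 h.le
    have h0 : P.pairing s k = 0 := le_antisymm h' (by rw [add]; positivity)
    rw [P.pairing_eq_zero_iff] at h0
    exact h.ne h0
  have e6 : P.pairing s r ≤ 0 := by
    rw [add]
    exact add_nonpos (pairing_nonpos_comm.1 e3) (pairing_nonpos_comm.1 e4)
  have e7 := pairing_nonpos_comm.1 e6
  rw [add', P.pairing_same] at e7
  linarith

end FiniteRoots

/-! ### Powers of an upper set of positive roots. -/

section UpperSets

variable {ι M N : Type*} [AddCommGroup M] [Module ℝ M] [AddCommGroup N] [Module ℝ N]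
  {P : RootPairing ι ℝ M N}

/-- A set of positive roots is an upper set if it is stable under adding positive roots. -/
structure IsUpper (b : P.Base) (Ψ : Set M) : Prop where
  subset : Ψ ⊆ finitePos b
  add_mem : ∀ x ∈ Ψ, ∀ y ∈ finitePos b, x + y ∈ range P.root → x + y ∈ Ψ

variable {b : P.Base} {Ψ : Set M}

theorem IsUpper.rootPower_subset (h : IsUpper b Ψ) (n : ℕ) : rootPower b Ψ n ⊆ finitePos b := by
  cases n with
  | zero => exact h.subset
  | succ n => exact fun x hx ↦ hx.1

variable [P.IsRootSystem]

theorem IsUpper.natCast_lt_heightForm (h : IsUpper b Ψ) {n : ℕ} {x : M}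
    (hx : x ∈ rootPower b Ψ n) : (n : ℝ) < heightForm b x := by
  induction n generalizing x with
  | zero => simpa using ((mem_finitePos_iff b).1 (h.subset hx)).2
  | succ n ih =>
    obtain ⟨-, y, hy, z, hz, rfl⟩ := hx
    have h1 := ih hy
    obtain ⟨i, hi, rfl⟩ := h.subset hz
    have h2 : (1 : ℝ) ≤ b.height i := by exact_mod_cast hi
    rw [map_add, heightForm_root b i]
    push_cast
    linarith

variable [Finite ι] [P.IsCrystallographic]

theorem IsUpper.rootBracket {Ψ' : Set M} (h' : IsUpper b Ψ') (h : IsUpper b Ψ) :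
    IsUpper b (rootBracket b Ψ' Ψ) where
  subset x hx := hx.1
  add_mem := by
    rintro _ ⟨hpos, x, hx, y, hy, rfl⟩ z hz hxyz
    have hp := add_mem_finitePos b hpos hz hxyz
    refine ⟨hp, ?_⟩
    have hx' := h'.subset hx
    have hy' := h.subset hy
    rcases add_mem_of_add_add_mem ((mem_finitePos_iff b).1 hx').1 ((mem_finitePos_iff b).1 hy').1
      ((mem_finitePos_iff b).1 hz).1 ((mem_finitePos_iff b).1 hpos).1 hxyz with h1 | h1
    · exact ⟨x + z, h'.add_mem x hx z hz
        (add_mem_range_root_of_pos hx' hz h1), y, hy, by abel⟩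
    · exact ⟨x, hx, y + z, h.add_mem y hy z hz
        (add_mem_range_root_of_pos hy' hz h1), by abel⟩

theorem IsUpper.rootPower (h : IsUpper b Ψ) (n : ℕ) : IsUpper b (rootPower b Ψ n) := by
  induction n with
  | zero => exact h
  | succ n ih => exact ih.rootBracket h

theorem IsUpper.rootPower_antitone (h : IsUpper b Ψ) : Antitone (AffineRoot.rootPower b Ψ) := by
  refine antitone_nat_of_succ_le fun n ↦ ?_
  rintro _ ⟨hpos, x, hx, y, hy, rfl⟩
  exact (h.rootPower n).add_mem x hx y (h.subset hy) ((mem_finitePos_iff b).1 hpos).1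

/-- Because of the index shift this reads `Ψ^(m+1) + Ψ^(n+1) ⊆ Ψ^(m+n+2)`. With `y = u + v` and `v ∈
Ψ`, one of `x + u`, `x + v` is a root: either `v` is added last, or it is moved over to `x`, and `n`
drops in both cases. -/
theorem IsUpper.add_mem_rootPower (h : IsUpper b Ψ) {m n : ℕ} {x y : M}
    (hx : x ∈ AffineRoot.rootPower b Ψ m) (hy : y ∈ AffineRoot.rootPower b Ψ n)
    (hxy : x + y ∈ range P.root) : x + y ∈ AffineRoot.rootPower b Ψ (m + n + 1) := by
  induction n generalizing m x y with
  | zero =>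
    exact ⟨add_mem_finitePos b ((h.rootPower m).subset hx) (h.subset hy) hxy, x, hx, y, hy, rfl⟩
  | succ n ih =>
    obtain ⟨hpos, u, hu, v, hv, rfl⟩ := hy
    have hx' := (mem_finitePos_iff b).1 ((h.rootPower m).subset hx)
    have hu' := (mem_finitePos_iff b).1 ((h.rootPower n).subset hu)
    have hv' := (mem_finitePos_iff b).1 (h.subset hv)
    have e : x + (u + v) = u + v + x := by abel
    rcases add_mem_of_add_add_mem hu'.1 hv'.1 hx'.1 ((mem_finitePos_iff b).1 hpos).1
      (e ▸ hxy) with h1 | h1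
    · have h2 := add_mem_range_root_of_pos (h.rootPower_subset n hu) (h.rootPower_subset m hx) h1
      have h3 := ih hx hu (by rwa [add_comm])
      refine ⟨(mem_finitePos_iff b).2 ⟨hxy, ?_⟩, x + u, ?_, v, hv, by abel⟩
      · simp only [map_add]; linarith [hx'.2, hu'.2, hv'.2]
      · exact h3
    · have h2 := add_mem_range_root_of_pos (h.subset hv) (h.rootPower_subset m hx) h1
      rw [add_comm] at h2
      have h3 : x + v ∈ AffineRoot.rootPower b Ψ (m + 1) :=
        ⟨add_mem_finitePos b ((h.rootPower m).subset hx) (h.subset hv) h2, x, hx, v, hv, rfl⟩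
      have e' : x + v + u = x + (u + v) := by abel
      have h4 := ih h3 hu (e' ▸ hxy)
      rwa [e', show m + 1 + n + 1 = m + (n + 1) + 1 by omega] at h4

/-- Write `x + y = z + w` with `w ∈ Ψ` and `z` one power lower. By `add_mem_of_add_add_mem` applied
to `x`, `y`, `-w`, one of `x - w`, `y - w` is a root or zero. `main` settles the case of `x - w`,
and the other is symmetric. -/
theorem IsUpper.mem_or_mem_rootPower (h : IsUpper b Ψ) {m n : ℕ} {x y : M}
    (hx : x ∈ finitePos b) (hy : y ∈ finitePos b)
    (hxy : x + y ∈ AffineRoot.rootPower b Ψ (m + n + 1)) :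
    x ∈ AffineRoot.rootPower b Ψ m ∨ y ∈ AffineRoot.rootPower b Ψ n := by
  induction hN : m + n using Nat.strong_induction_on generalizing m n x y with
  | _ N ih =>
  subst hN
  have main {m' n' : ℕ} {x y z w : M} (hmn : m' + n' = m + n) (hx : x ∈ finitePos b)
      (hy : y ∈ finitePos b) (hz : z ∈ AffineRoot.rootPower b Ψ (m + n)) (hw : w ∈ Ψ)
      (e : x + y = z + w) (hxw : x + -w ∈ range P.root ∨ x + -w = 0) :
      x ∈ AffineRoot.rootPower b Ψ m' ∨ y ∈ AffineRoot.rootPower b Ψ n' := by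
    rcases hxw with hr | h0
    · have ey : y = z + -(x + -w) := by rw [← sub_eq_iff_eq_add'.2 e]; abel
      have ex : x = (x + -w) + w := by abel
      -- If `x - w` is positive, `z = (x - w) + y` allows induction; if it is negative, `y = z + (w
      -- - x)` inherits membership from `z`.
      rcases mem_finitePos_or_neg b hr with hr | hr
      · rcases m' with _ | m'
        · left
          rw [ex, add_comm]
          exact h.add_mem w hw _ hr (by rw [add_comm, ← ex]; exact ((mem_finitePos_iff b).1 hx).1)
        · have ez : z = (x + -w) + y := by
            rw [eq_sub_of_add_eq e.symm]; abel
          rw [ez, show m + n = m' + n' + 1 by omega] at hz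
          refine (ih (m' + n') (by omega) hr hy hz rfl).imp_left fun h1 ↦ ?_
          exact ⟨hx, x + -w, h1, w, hw, ex⟩
      · right
        refine h.rootPower_antitone (show n' ≤ m + n by omega) ?_
        rw [ey]
        exact (h.rootPower _).add_mem z hz _ hr (ey ▸ ((mem_finitePos_iff b).1 hy).1)
    · right
      have ex : x = w := by rwa [← sub_eq_add_neg, sub_eq_zero] at h0
      have ey : y = z := by rw [ex, add_comm z] at e; exact add_left_cancel e
      exact h.rootPower_antitone (show n' ≤ m + n by omega) (ey ▸ hz)
  obtain ⟨hpos, z, hz, w, hw, e⟩ := hxy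
  have hz' := (mem_finitePos_iff b).1 ((h.rootPower _).subset hz)
  have hw' := (mem_finitePos_iff b).1 (h.subset hw)
  have e' : x + y + -w = z := by rw [e]; abel
  rcases add_mem_of_add_add_mem ((mem_finitePos_iff b).1 hx).1 ((mem_finitePos_iff b).1 hy).1
    (neg_mem_range_root hw'.1) ((mem_finitePos_iff b).1 hpos).1 (e' ▸ hz'.1) with h1 | h1
  · exact main rfl hx hy hz hw e h1
  · exact (main (add_comm n m) hy hx hz hw (by rw [add_comm, e]) h1).symm

end UpperSets

/-! ### Affine roots and a height form detecting positivity. -/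

section AffineRoots

variable {ι M N : Type*} [AddCommGroup M] [Module ℝ M] [AddCommGroup N] [Module ℝ N]
  {P : RootPairing ι ℝ M N}

/-- The affine root `α + kδ`. -/
def affineRoot (P : RootPairing ι ℝ M N) (i : ι) (k : ℤ) : M × ℝ := (P.root i, (k : ℝ))

theorem emb_add_smul_delta (x : M) (r : ℝ) : emb x + r • delta M = (x, r) := by
  simp [emb, delta]

theorem affineRoot_eq (i : ι) (k : ℤ) :
    affineRoot P i k = emb (P.root i) + (k : ℝ) • delta M :=
  (emb_add_smul_delta _ _).symm

theorem neg_affineRoot (i : ι) (k : ℤ) :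
    -affineRoot P i k = affineRoot P (P.reflectionPerm i i) (-k) := by
  simp [affineRoot]

theorem affineRoot_injective {i j : ι} {k l : ℤ} (h : affineRoot P i k = affineRoot P j l) :
    i = j ∧ k = l := by
  simpa [affineRoot] using h

/-- A strict upper bound for the absolute values of the heights of the roots. -/
noncomputable def heightBound (b : P.Base) : ℤ := 1 + ∑ᶠ i, |b.height i|

theorem heightBound_pos (b : P.Base) : 0 < heightBound b := by
  have : 0 ≤ ∑ᶠ i, |b.height i| := finsum_nonneg fun _ ↦ abs_nonneg _
  unfold heightBound
  linarith

theorem affinePos_subset_range (b : P.Base) {x : M × ℝ} (hx : x ∈ affinePos b) :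
    ∃ i k, x = affineRoot P i k := by
  rcases hx with ⟨_, ⟨j, hj, rfl⟩, n, h⟩ | ⟨_, ⟨j, hj, rfl⟩, n, hn, h⟩
  · exact ⟨j, n, by rw [h, affineRoot_eq]; simp⟩
  · exact ⟨P.reflectionPerm j j, n, by rw [h, affineRoot_eq]; simp⟩

theorem mem_affinePos_or_neg (b : P.Base) {x : M × ℝ} (hx : x ∈ affineRoots b) :
    x ∈ affinePos b ∨ -x ∈ affinePos b := hx

theorem abs_height_lt [Finite ι] (b : P.Base) (i : ι) : |b.height i| < heightBound b := by
  have : Fintype ι := Fintype.ofFinite ι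
  rw [heightBound, finsum_eq_sum_of_fintype]
  have := Finset.single_le_sum (f := fun i ↦ |b.height i|) (fun _ _ ↦ abs_nonneg _)
    (Finset.mem_univ i)
  linarith

/-- Since `heightBound` exceeds every `|b.height i|`, the `δ`-coefficient decides the sign unless it
vanishes. -/
theorem affineRoot_pos_iff [Finite ι] (b : P.Base) (i : ι) (k : ℤ) :
    0 < b.height i + k * heightBound b ↔ 1 ≤ k ∨ k = 0 ∧ 0 < b.height i := by
  have h := abs_lt.1 (abs_height_lt b i)
  rcases lt_trichotomy k 0 with hk | rfl | hk
  · have : k * heightBound b ≤ - heightBound b := by nlinarith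
    constructor
    · intro; linarith
    · omega
  · simp
  · have : heightBound b ≤ k * heightBound b := by nlinarith
    constructor
    · intro; omega
    · intro; linarith

variable [P.IsRootSystem]

/-- A linear form on `V` which is positive on the positive affine roots and integral on
the affine roots. -/
noncomputable def affineHeight (b : P.Base) : (M × ℝ) →ₗ[ℝ] ℝ :=
  (heightForm b).coprod ((heightBound b : ℝ) • LinearMap.id)

theorem affineHeight_affineRoot (b : P.Base) (i : ι) (k : ℤ) :
    affineHeight b (affineRoot P i k) = (b.height i + k * heightBound b : ℤ) := by
  simp [affineHeight, affineRoot, heightForm_root]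
  ring

theorem affineHeight_delta_pos (b : P.Base) : 0 < affineHeight b (delta M) := by
  simpa [affineHeight, delta] using heightBound_pos b

variable [Finite ι]

theorem affineHeight_pos_iff (b : P.Base) (i : ι) (k : ℤ) :
    0 < affineHeight b (affineRoot P i k) ↔ 1 ≤ k ∨ k = 0 ∧ b.IsPos i := by
  rw [affineHeight_affineRoot, RootPairing.Base.isPos_iff, ← affineRoot_pos_iff]
  exact_mod_cast Iff.rfl

theorem affineRoot_mem_affinePos_iff (b : P.Base) (i : ι) (k : ℤ) :
    affineRoot P i k ∈ affinePos b ↔ 0 < affineHeight b (affineRoot P i k) := by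
  rw [affineHeight_pos_iff]
  constructor
  · rintro (⟨_, ⟨j, hj, rfl⟩, n, h⟩ | ⟨_, ⟨j, hj, rfl⟩, n, hn, h⟩)
    · have h' : affineRoot P i k = affineRoot P j n := by rw [h, affineRoot_eq]; simp
      obtain ⟨rfl, rfl⟩ := affineRoot_injective h'
      rcases n.eq_zero_or_pos with h0 | h0
      · exact .inr ⟨by simp [h0], hj⟩
      · exact .inl (by exact_mod_cast h0)
    · have h' : affineRoot P i k = affineRoot P (P.reflectionPerm j j) n := by
        rw [h, affineRoot_eq]; simp
      obtain ⟨rfl, rfl⟩ := affineRoot_injective h'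
      omega
  · intro h
    obtain ⟨n, rfl⟩ := Int.eq_ofNat_of_zero_le (show 0 ≤ k by omega)
    by_cases hi : b.IsPos i
    · exact .inl ⟨_, ⟨i, hi, rfl⟩, n, by rw [affineRoot_eq]; simp⟩
    · refine .inr ⟨_, ⟨P.reflectionPerm i i, ?_, rfl⟩, n, ?_, by rw [affineRoot_eq]; simp⟩
      · exact (RootPairing.Base.IsPos.neg_iff_not b i).2 hi
      · exact_mod_cast h.resolve_right fun h' ↦ hi h'.2

theorem affineHeight_affineRoot_ne_zero (b : P.Base) (i : ι) (k : ℤ) :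
    affineHeight b (affineRoot P i k) ≠ 0 := by
  rw [affineHeight_affineRoot, Int.cast_ne_zero]
  have h := abs_lt.1 (abs_height_lt b i)
  have h0 := b.height_ne_zero i
  rcases lt_trichotomy k 0 with hk | rfl | hk
  · nlinarith
  · simpa
  · nlinarith

theorem mem_affineRoots_iff (b : P.Base) {x : M × ℝ} :
    x ∈ affineRoots b ↔ ∃ i k, x = affineRoot P i k := by
  constructor
  · rintro (h | h)
    · exact affinePos_subset_range b h
    · obtain ⟨i, k, h⟩ := affinePos_subset_range b h
      exact ⟨P.reflectionPerm i i, -k, by rw [← neg_affineRoot, ← h, neg_neg]⟩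
  · rintro ⟨i, k, rfl⟩
    rcases lt_or_gt_of_ne (affineHeight_affineRoot_ne_zero b i k) with h | h
    · right
      change -_ ∈ affinePos b
      rw [neg_affineRoot, affineRoot_mem_affinePos_iff, ← neg_affineRoot, map_neg]
      linarith
    · exact .inl ((affineRoot_mem_affinePos_iff b i k).2 h)

theorem mem_affinePos_iff (b : P.Base) {x : M × ℝ} :
    x ∈ affinePos b ↔ x ∈ affineRoots b ∧ 0 < affineHeight b x := by
  constructor
  · intro h
    refine ⟨.inl h, ?_⟩
    obtain ⟨i, k, rfl⟩ := affinePos_subset_range b h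
    exact (affineRoot_mem_affinePos_iff b i k).1 h
  · rintro ⟨h, h'⟩
    obtain ⟨i, k, rfl⟩ := (mem_affineRoots_iff b).1 h
    exact (affineRoot_mem_affinePos_iff b i k).2 h'

theorem neg_mem_affineRoots (b : P.Base) {x : M × ℝ} (hx : x ∈ affineRoots b) :
    -x ∈ affineRoots b := by
  obtain ⟨i, k, rfl⟩ := (mem_affineRoots_iff b).1 hx
  exact (mem_affineRoots_iff b).2 ⟨_, _, neg_affineRoot i k⟩

theorem mem_affineNeg_iff (b : P.Base) {x : M × ℝ} :
    x ∈ affineNeg b ↔ x ∈ affineRoots b ∧ affineHeight b x < 0 := by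
  change -x ∈ affinePos b ↔ _
  rw [mem_affinePos_iff, map_neg, neg_pos]
  exact ⟨fun h ↦ ⟨by simpa using neg_mem_affineRoots b h.1, h.2⟩,
    fun h ↦ ⟨neg_mem_affineRoots b h.1, h.2⟩⟩

theorem affineHeight_ne_zero (b : P.Base) {x : M × ℝ} (hx : x ∈ affineRoots b) :
    affineHeight b x ≠ 0 := by
  obtain ⟨i, k, rfl⟩ := (mem_affineRoots_iff b).1 hx
  exact affineHeight_affineRoot_ne_zero b i k

theorem add_mem_affinePos (b : P.Base) {x y : M × ℝ} (hx : x ∈ affinePos b)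
    (hy : y ∈ affinePos b) (hxy : x + y ∈ affineRoots b) : x + y ∈ affinePos b := by
  rw [mem_affinePos_iff] at *
  exact ⟨hxy, by rw [map_add]; linarith [hx.2, hy.2]⟩

theorem add_smul_delta_mem_affineRoots (b : P.Base) {x : M × ℝ} (hx : x ∈ affineRoots b) (n : ℤ) :
    x + (n : ℝ) • delta M ∈ affineRoots b := by
  obtain ⟨i, k, rfl⟩ := (mem_affineRoots_iff b).1 hx
  exact (mem_affineRoots_iff b).2 ⟨i, k + n, by simp [affineRoot, delta]⟩

theorem add_smul_delta_mem_affinePos (b : P.Base) {x : M × ℝ} (hx : x ∈ affinePos b) (n : ℕ) :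
    x + (n : ℝ) • delta M ∈ affinePos b := by
  rw [mem_affinePos_iff] at *
  refine ⟨add_smul_delta_mem_affineRoots b hx.1 n, ?_⟩
  have := affineHeight_delta_pos b
  rw [map_add, map_smul, smul_eq_mul]
  have h2 := hx.2
  positivity

/-- Well-founded induction on positive affine roots along `affineHeight`. -/
theorem affinePos_induction (b : P.Base) {p : M × ℝ → Prop}
    (ih : ∀ x ∈ affinePos b,
      (∀ y ∈ affinePos b, affineHeight b y < affineHeight b x → p y) → p x)
    {x : M × ℝ} (hx : x ∈ affinePos b) : p x := by
  have key (n : ℕ) : ∀ x ∈ affinePos b, affineHeight b x = n → p x := by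
    induction n using Nat.strong_induction_on with
    | _ n hn =>
      intro x hx hxn
      refine ih x hx fun y hy hyx ↦ ?_
      obtain ⟨hy1, hy2⟩ := (mem_affinePos_iff b).1 hy
      obtain ⟨i, k, rfl⟩ := (mem_affineRoots_iff b).1 hy1
      rw [affineHeight_affineRoot] at hyx hy2
      obtain ⟨m, hm⟩ := Int.eq_ofNat_of_zero_le (Int.cast_pos.1 hy2).le
      refine hn m ?_ _ hy ?_
      · rw [hm, hxn] at hyx; exact_mod_cast hyx
      · rw [affineHeight_affineRoot, hm]; simp
  obtain ⟨hx1, hx2⟩ := (mem_affinePos_iff b).1 hx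
  obtain ⟨i, k, rfl⟩ := (mem_affineRoots_iff b).1 hx1
  rw [affineHeight_affineRoot] at hx2
  obtain ⟨m, hm⟩ := Int.eq_ofNat_of_zero_le (Int.cast_pos.1 hx2).le
  exact key m _ hx (by rw [affineHeight_affineRoot, hm]; simp)

end AffineRoots

/-! ### Affine reflections and their action on affine roots. -/

section Reflections

variable {ι M N : Type*} [AddCommGroup M] [Module ℝ M] [AddCommGroup N] [Module ℝ N]
  {P : RootPairing ι ℝ M N}

theorem affineReflection_apply (i : ι) (k : ℤ) (x : M × ℝ) :
    affineReflection P i k x = x - P.coroot' i x.1 • affineRoot P i k := by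
  rw [affineRoot_eq]
  exact Module.reflection_apply _ _

theorem affineReflection_self (i : ι) (k : ℤ) :
    affineReflection P i k (affineRoot P i k) = -affineRoot P i k := by
  rw [affineReflection_apply]
  simp only [affineRoot, P.root_coroot'_eq_pairing, P.pairing_same, two_smul]
  abel

theorem affineReflection_affineReflection (i : ι) (k : ℤ) (x : M × ℝ) :
    affineReflection P i k (affineReflection P i k x) = x :=
  Module.involutive_reflection _ x

theorem affineReflection_mul_self (i : ι) (k : ℤ) :
    affineReflection P i k * affineReflection P i k = 1 :=
  LinearEquiv.ext fun x ↦ affineReflection_affineReflection i k x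

theorem affineReflection_delta (i : ι) (k : ℤ) : affineReflection P i k (delta M) = delta M := by
  simp [affineReflection_apply, delta]

theorem affineReflection_mem (i : ι) (k : ℤ) : affineReflection P i k ∈ affineWeylGroup P :=
  Subgroup.subset_closure ⟨i, k, rfl⟩

variable [P.IsCrystallographic]

theorem affineReflection_affineRoot (i : ι) (k : ℤ) (j : ι) (l : ℤ) :
    affineReflection P i k (affineRoot P j l) =
      affineRoot P (P.reflectionPerm i j) (l - P.pairingIn ℤ j i * k) := by
  rw [affineReflection_apply]
  have : ((P.pairingIn ℤ j i : ℤ) : ℝ) = P.pairing j i := P.algebraMap_pairingIn ℤ j i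
  ext
  · simp [affineRoot, P.root_reflectionPerm, P.reflection_apply]
  · simp [affineRoot, this]

theorem affineReflection_conj (i : ι) (k : ℤ) (j : ι) (l : ℤ) :
    affineReflection P (P.reflectionPerm i j) (l - P.pairingIn ℤ j i * k) =
      affineReflection P i k * affineReflection P j l * (affineReflection P i k)⁻¹ := by
  rw [eq_mul_inv_iff_mul_eq]
  refine LinearEquiv.ext fun x ↦ ?_
  change affineReflection P _ _ (affineReflection P i k x) =
    affineReflection P i k (affineReflection P j l x)
  rw [affineReflection_apply (P.reflectionPerm i j), affineReflection_apply j, map_sub, map_smul,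
    affineReflection_affineRoot]
  congr 2
  rw [P.coroot'_reflectionPerm, affineReflection_apply]
  have : (x - P.coroot' i x.1 • affineRoot P i k).1 = P.reflection i x.1 := by
    simp [affineRoot, P.reflection_apply]
  rw [this]
  simp

/-- The affine Weyl group permutes the affine roots, compatibly with the reflections. -/
theorem exists_affineRoot_conj {w : (M × ℝ) ≃ₗ[ℝ] (M × ℝ)} (hw : w ∈ affineWeylGroup P)
    (i : ι) (k : ℤ) :
    ∃ j l, w (affineRoot P i k) = affineRoot P j l ∧
      affineReflection P j l = w * affineReflection P i k * w⁻¹ := by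
  induction hw using Subgroup.closure_induction_left generalizing i k with
  | one => exact ⟨i, k, rfl, by simp⟩
  | mul_left s hs w hw ih =>
    obtain ⟨i', k', rfl⟩ := hs
    obtain ⟨j, l, h1, h2⟩ := ih i k
    refine ⟨_, _, ?_, (affineReflection_conj i' k' j l).trans ?_⟩
    · change affineReflection P i' k' (w _) = _
      rw [h1, affineReflection_affineRoot]
    · rw [h2]; group
  | inv_mul_cancel s hs w hw ih =>
    obtain ⟨i', k', rfl⟩ := hs
    rw [inv_eq_of_mul_eq_one_left (affineReflection_mul_self i' k')]
    obtain ⟨j, l, h1, h2⟩ := ih i k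
    refine ⟨_, _, ?_, (affineReflection_conj i' k' j l).trans ?_⟩
    · change affineReflection P i' k' (w _) = _
      rw [h1, affineReflection_affineRoot]
    · rw [h2]; group

variable [P.IsRootSystem] [Finite ι]

theorem affineWeylGroup_apply_mem (b : P.Base) {w : (M × ℝ) ≃ₗ[ℝ] (M × ℝ)}
    (hw : w ∈ affineWeylGroup P) {x : M × ℝ} (hx : x ∈ affineRoots b) : w x ∈ affineRoots b := by
  obtain ⟨i, k, rfl⟩ := (mem_affineRoots_iff b).1 hx
  obtain ⟨j, l, h, -⟩ := exists_affineRoot_conj hw i k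
  exact (mem_affineRoots_iff b).2 ⟨j, l, h⟩

theorem mem_inversionSet_iff (b : P.Base) (w : affineWeylGroup P) {x : M × ℝ} :
    x ∈ inversionSet b w ↔ x ∈ affinePos b ∧ affineHeight b (w.1⁻¹ x) < 0 := by
  refine and_congr_right fun hx ↦ ?_
  have h : x ∈ w.1 '' affineNeg b ↔ w.1⁻¹ x ∈ affineNeg b := by
    constructor
    · rintro ⟨y, hy, rfl⟩
      change w.1.symm _ ∈ _
      simpa
    · exact fun h ↦ ⟨_, h, w.1.apply_symm_apply x⟩
  rw [h, mem_affineNeg_iff]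
  exact and_iff_right (affineWeylGroup_apply_mem b (inv_mem w.2) (.inl hx))

end Reflections

/-! ### Simple affine roots, exchange, and injectivity of `w ↦ N(w)`. -/

section Simple

variable {ι M N : Type*} [AddCommGroup M] [Module ℝ M] [AddCommGroup N] [Module ℝ N]
  {P : RootPairing ι ℝ M N}

/-- A positive affine root is simple if it is neither a sum of two positive affine roots, nor the
sum of a positive affine root and `δ`. -/
structure IsSimpleRoot (b : P.Base) (a : M × ℝ) : Prop where
  mem : a ∈ affinePos b
  ne_add : ∀ x ∈ affinePos b, ∀ y ∈ affinePos b, a ≠ x + y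
  ne_add_delta : ∀ x ∈ affinePos b, a ≠ x + delta M

/-- The reflections in the simple affine roots. -/
def simpleReflections (b : P.Base) : Set ((M × ℝ) ≃ₗ[ℝ] (M × ℝ)) :=
  {r | ∃ i k, IsSimpleRoot b (affineRoot P i k) ∧ r = affineReflection P i k}

theorem affineReflection_neg (i : ι) (k : ℤ) :
    affineReflection P (P.reflectionPerm i i) (-k) = affineReflection P i k := by
  refine LinearEquiv.ext fun x ↦ ?_
  have h : P.coroot' (P.reflectionPerm i i) = -P.coroot' i := by
    ext y
    simp [RootPairing.coroot', P.coroot_reflectionPerm]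
  rw [affineReflection_apply, affineReflection_apply, ← neg_affineRoot, h]
  simp

theorem simpleReflections_prod_mem {b : P.Base} {l : List ((M × ℝ) ≃ₗ[ℝ] (M × ℝ))}
    (hl : ∀ r ∈ l, r ∈ simpleReflections b) : l.prod ∈ affineWeylGroup P := by
  refine Subgroup.list_prod_mem _ fun r hr ↦ ?_
  obtain ⟨i, k, -, rfl⟩ := hl r hr
  exact affineReflection_mem i k

variable [P.IsRootSystem] [Finite ι] {b : P.Base}

theorem not_neg_mem_affinePos {x : M × ℝ} (hx : x ∈ affinePos b) : -x ∉ affinePos b := by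
  rw [mem_affinePos_iff] at *
  rw [map_neg]
  intro h
  linarith [h.2, hx.2]

theorem IsSimpleRoot.ne_add_smul_delta {a x : M × ℝ} (ha : IsSimpleRoot b a)
    (hx : x ∈ affinePos b) {n : ℕ} (hn : n ≠ 0) : a ≠ x + (n : ℝ) • delta M := by
  obtain ⟨n, rfl⟩ := Nat.exists_eq_succ_of_ne_zero hn
  have := ha.ne_add_delta _ (add_smul_delta_mem_affinePos b hx n)
  rwa [add_assoc, show (n : ℝ) • delta M + delta M = (n.succ : ℝ) • delta M by
    rw [Nat.cast_succ, add_smul, one_smul]] at this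

variable [P.IsCrystallographic]

/-- Otherwise the coroot of `i` is nonpositive on simple roots, hence on all positive roots by
decomposing them (`δ` pairs to zero), contradicting its value `2` on the root itself. -/
theorem exists_isSimpleRoot_pairing_pos {i : ι} {k : ℤ} (hi : affineRoot P i k ∈ affinePos b) :
    ∃ j l, IsSimpleRoot b (affineRoot P j l) ∧ 0 < P.pairing i j := by
  by_contra! h
  have key {x : M × ℝ} (hx : x ∈ affinePos b) : P.coroot' i x.1 ≤ 0 := by
    refine affinePos_induction b (p := fun x ↦ P.coroot' i x.1 ≤ 0) (fun x hx ih ↦ ?_) hx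
    by_cases hs : IsSimpleRoot b x
    · obtain ⟨j, l, rfl⟩ := affinePos_subset_range b hx
      change P.coroot' i (P.root j) ≤ 0
      rw [P.root_coroot'_eq_pairing]
      exact pairing_nonpos_comm.1 (h j l hs)
    have hdec : (∃ y ∈ affinePos b, ∃ z ∈ affinePos b, x = y + z) ∨
        ∃ y ∈ affinePos b, x = y + delta M := by
      by_contra! hc
      exact hs ⟨hx, hc.1, hc.2⟩
    rcases hdec with ⟨y, hy, z, hz, rfl⟩ | ⟨y, hy, rfl⟩
    · have hy' := ((mem_affinePos_iff b).1 hy).2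
      have hz' := ((mem_affinePos_iff b).1 hz).2
      have h1 := ih y hy (by rw [map_add]; linarith)
      have h2 := ih z hz (by rw [map_add]; linarith)
      rw [Prod.fst_add, map_add]
      linarith
    · have h1 := ih y hy (by rw [map_add]; linarith [affineHeight_delta_pos b])
      simpa [delta] using h1
  have := key hi
  change P.coroot' i (P.root i) ≤ 0 at this
  rw [P.root_coroot'_eq_pairing, P.pairing_same] at this
  linarith

variable [P.IsReduced]

/-- A simple reflection permutes the positive affine roots other than its root. -/
theorem IsSimpleRoot.reflection_mem {i : ι} {k : ℤ} (ha : IsSimpleRoot b (affineRoot P i k))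
    {x : M × ℝ} (hx : x ∈ affinePos b) (hxa : x ≠ affineRoot P i k) :
    affineReflection P i k x ∈ affinePos b := by
  obtain ⟨j, l, rfl⟩ := affinePos_subset_range b hx
  induction hn : (P.pairingIn ℤ j i).toNat using Nat.strong_induction_on generalizing j l with
  | _ n ih =>
  have hs : affineReflection P i k (affineRoot P j l) ∈ affineRoots b :=
    affineWeylGroup_apply_mem b (affineReflection_mem i k) (.inl hx)
  by_contra hcon
  have hneg := (mem_affinePos_or_neg b hs).resolve_left hcon
  have hpair : ((P.pairingIn ℤ j i : ℤ) : ℝ) = P.pairing j i := P.algebraMap_pairingIn ℤ j i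
  -- If the pairing were nonpositive, reflecting would add a nonnegative multiple of the simple
  -- root, keeping the height positive.
  have hpos : 0 < P.pairingIn ℤ j i := by
    by_contra! h
    refine hcon ((mem_affinePos_iff b).2 ⟨hs, ?_⟩)
    have h1 := ((mem_affinePos_iff b).1 hx).2
    have h2 := ((mem_affinePos_iff b).1 ha.mem).2
    have h3 : P.pairing j i ≤ 0 := by rw [← hpair]; exact_mod_cast h
    rw [affineReflection_apply, map_sub, map_smul, smul_eq_mul,
      show (affineRoot P j l).1 = P.root j from rfl, P.root_coroot'_eq_pairing]
    nlinarith
  rcases root_sub_root_of_pairing_pos (P := P) (i := j) (j := i)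
    (by rw [← hpair]; exact_mod_cast hpos) with ⟨m, hm⟩ | h0
  · have hy : affineRoot P m (l - k) = affineRoot P j l - affineRoot P i k := by
      simp [affineRoot, hm]
    have hyR : affineRoot P m (l - k) ∈ affineRoots b := (mem_affineRoots_iff b).2 ⟨_, _, rfl⟩
    have hyp : affineRoot P m (l - k) ∈ affinePos b := by
      refine (mem_affinePos_or_neg b hyR).resolve_right fun h ↦ ?_
      exact ha.ne_add _ hx _ h (by rw [hy]; abel)
    have hya : affineRoot P m (l - k) ≠ affineRoot P i k := by
      intro h
      have hmi := (affineRoot_injective h).1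
      subst hmi
      have : IsAddTorsionFree M := .of_isTorsionFree ℝ M
      exact P.nsmul_notMem_range_root (n := 2) (i := m)
        ⟨j, by rw [two_smul]; exact eq_add_of_sub_eq hm.symm⟩
    have hp2 : P.pairingIn ℤ m i = P.pairingIn ℤ j i - 2 := by
      have : P.pairing m i = P.pairing j i - 2 := by
        simp only [← P.root_coroot'_eq_pairing, hm, map_sub]
        simp
      rw [← P.algebraMap_pairingIn ℤ, ← P.algebraMap_pairingIn ℤ] at this
      simp only [algebraMap_int_eq, eq_intCast] at this
      exact_mod_cast this
    -- With `x` the given root and `a` the simple one, passing to `x - a` lowers the pairing by `2`,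
    -- so `s(x - a) = s(x) + a` is positive. Then `a = s(x - a) + (-s(x))` is a forbidden
    -- decomposition.
    have := ih _ (by omega) m (l - k) hyp hya rfl
    refine ha.ne_add _ this _ hneg ?_
    rw [hy, map_sub, affineReflection_self]
    abel
  · have hji : j = i := P.root.injective (sub_eq_zero.1 h0)
    subst hji
    -- Now `x = a + (l - k)δ` and `-s(x) = a - (l - k)δ`. Whatever the sign of `l - k`, one of these
    -- exhibits `a` as a positive root plus a positive multiple of `δ`.
    have hkl : l ≠ k := fun h ↦ hxa (by rw [h])
    have hδ (p q : ℤ) (n : ℕ) (h : p = q + n) :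
        affineRoot P j p = affineRoot P j q + (n : ℝ) • delta M := by
      simp [affineRoot, delta, h]
    rcases lt_or_gt_of_ne hkl with h | h
    · exact ha.ne_add_smul_delta hx (n := (k - l).toNat) (by omega) (hδ _ _ _ (by omega))
    · have e : -(affineReflection P j k (affineRoot P j l)) = affineRoot P j (2 * k - l) := by
        rw [affineReflection_apply]
        simp [affineRoot, two_smul, two_mul]
      rw [e] at hneg
      exact ha.ne_add_smul_delta hneg (n := (l - k).toNat) (by omega) (hδ _ _ _ (by omega))

-- Induction on height: a simple root pairing positively with the given positive root reflects it to
-- a lower positive root, and the two reflections are conjugate by a simple one.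
variable (b) in
theorem affineReflection_mem_closure (i : ι) (k : ℤ) :
    affineReflection P i k ∈ Subgroup.closure (simpleReflections b) := by
  have key {x : M × ℝ} (hx : x ∈ affinePos b) : ∀ i k, x = affineRoot P i k →
      affineReflection P i k ∈ Subgroup.closure (simpleReflections b) := by
    refine affinePos_induction b (p := fun x ↦ ∀ i k, x = affineRoot P i k →
      affineReflection P i k ∈ Subgroup.closure (simpleReflections b)) (fun x hx ih ↦ ?_) hx
    rintro i k rfl
    obtain ⟨j, l, hs, hp⟩ := exists_isSimpleRoot_pairing_pos hx
    have hsm : affineReflection P j l ∈ Subgroup.closure (simpleReflections b) :=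
      Subgroup.subset_closure ⟨j, l, hs, rfl⟩
    by_cases hij : affineRoot P i k = affineRoot P j l
    · obtain ⟨rfl, rfl⟩ := affineRoot_injective hij
      exact hsm
    have hy := hs.reflection_mem hx hij
    have hlt : affineHeight b (affineReflection P j l (affineRoot P i k)) <
        affineHeight b (affineRoot P i k) := by
      have h2 := ((mem_affinePos_iff b).1 hs.mem).2
      rw [affineReflection_apply, map_sub, map_smul, smul_eq_mul,
        show (affineRoot P i k).1 = P.root i from rfl, P.root_coroot'_eq_pairing]
      have := mul_pos hp h2
      linarith
    have := ih _ hy hlt _ _ (affineReflection_affineRoot j l i k)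
    rw [affineReflection_conj] at this
    have h3 := mul_mem (mul_mem (inv_mem hsm) this) hsm
    simpa [mul_assoc] using h3
  rcases mem_affinePos_or_neg b ((mem_affineRoots_iff b).2 ⟨i, k, rfl⟩) with h | h
  · exact key h i k rfl
  · rw [← affineReflection_neg]
    exact key h _ _ (neg_affineRoot i k)

variable (b) in
theorem exists_list_simpleReflections {w : (M × ℝ) ≃ₗ[ℝ] (M × ℝ)} (hw : w ∈ affineWeylGroup P) :
    ∃ l : List ((M × ℝ) ≃ₗ[ℝ] (M × ℝ)), (∀ r ∈ l, r ∈ simpleReflections b) ∧ l.prod = w := by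
  have h : affineWeylGroup P ≤ Subgroup.closure (simpleReflections b) := by
    refine (Subgroup.closure_le _).2 ?_
    rintro _ ⟨i, k, rfl⟩
    exact affineReflection_mem_closure b i k
  have cons {r w : (M × ℝ) ≃ₗ[ℝ] (M × ℝ)} (hr : r ∈ simpleReflections b)
      (hw : ∃ l : List ((M × ℝ) ≃ₗ[ℝ] (M × ℝ)),
        (∀ r ∈ l, r ∈ simpleReflections b) ∧ l.prod = w) :
      ∃ l : List ((M × ℝ) ≃ₗ[ℝ] (M × ℝ)),
        (∀ r ∈ l, r ∈ simpleReflections b) ∧ l.prod = r * w := by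
    obtain ⟨l, hl, rfl⟩ := hw
    exact ⟨r :: l, by simpa using ⟨hr, hl⟩, List.prod_cons⟩
  replace hw := h hw
  clear h
  induction hw using Subgroup.closure_induction_left with
  | one => exact ⟨[], by simp, rfl⟩
  | mul_left r hr w _ ih => exact cons hr ih
  | inv_mul_cancel r hr w _ ih =>
    have hinv : r⁻¹ = r := by
      obtain ⟨i, k, -, rfl⟩ := hr
      exact inv_eq_of_mul_eq_one_left (affineReflection_mul_self i k)
    rw [hinv]
    exact cons hr ih

/-- The exchange property. -/
theorem exists_shorter_list {l : List ((M × ℝ) ≃ₗ[ℝ] (M × ℝ))}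
    (hl : ∀ r ∈ l, r ∈ simpleReflections b) {i : ι} {k : ℤ}
    (ha : IsSimpleRoot b (affineRoot P i k)) (h : -(l.prod (affineRoot P i k)) ∈ affinePos b) :
    ∃ l' : List ((M × ℝ) ≃ₗ[ℝ] (M × ℝ)), (∀ r ∈ l', r ∈ simpleReflections b) ∧
      l'.length + 1 = l.length ∧ l'.prod = l.prod * affineReflection P i k := by
  induction l with
  | nil => exact absurd h (not_neg_mem_affinePos ha.mem)
  | cons r l ih =>
    have hl' : ∀ r ∈ l, r ∈ simpleReflections b := fun r hr ↦ hl r (List.mem_cons_of_mem _ hr)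
    have hw := simpleReflections_prod_mem hl'
    rcases mem_affinePos_or_neg b (affineWeylGroup_apply_mem b hw (.inl ha.mem)) with hp | hp
    · obtain ⟨i', k', hs, rfl⟩ := hl r List.mem_cons_self
      -- The first letter `r` makes a positive root negative, so that root is its own. Hence `r` is
      -- the conjugate of the reflection in the given root by `l.prod`, and deleting `r` gives the
      -- shorter word.
      have e : l.prod (affineRoot P i k) = affineRoot P i' k' := by
        by_contra hne
        refine not_neg_mem_affinePos (hs.reflection_mem hp hne) ?_
        simpa using h
      obtain ⟨j, m, h1, h2⟩ := exists_affineRoot_conj hw i k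
      obtain ⟨rfl, rfl⟩ := affineRoot_injective (e.symm.trans h1)
      refine ⟨l, hl', rfl, ?_⟩
      rw [List.prod_cons, h2]
      simp [mul_assoc, affineReflection_mul_self]
    · obtain ⟨l', h1, h2, h3⟩ := ih hl' hp
      refine ⟨r :: l', ?_, by simp [h2], by simp [h3, mul_assoc]⟩
      simpa using ⟨hl r List.mem_cons_self, h1⟩

-- If the word ends in the reflection of a simple root `a`, positivity of `w a` means that the
-- remaining prefix makes `a` negative. Exchange then gives a word for `w` two letters shorter.
variable (b) in
theorem eq_one_of_preserves_affinePos {w : (M × ℝ) ≃ₗ[ℝ] (M × ℝ)} (hw : w ∈ affineWeylGroup P)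
    (h : ∀ x ∈ affinePos b, w x ∈ affinePos b) : w = 1 := by
  obtain ⟨l, hl, rfl⟩ := exists_list_simpleReflections b hw
  clear hw
  induction hn : l.length using Nat.strong_induction_on generalizing l with
  | _ n ih =>
  rcases l.eq_nil_or_concat with rfl | ⟨l, r, rfl⟩
  · rfl
  obtain ⟨i, k, hs, rfl⟩ := hl r (by simp)
  have hl' : ∀ r ∈ l, r ∈ simpleReflections b := fun r hr ↦ hl r (by simp [hr])
  have hprod : (l.concat (affineReflection P i k)).prod = l.prod * affineReflection P i k := by simp
  have hneg : -(l.prod (affineRoot P i k)) ∈ affinePos b := by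
    have := h _ hs.mem
    rw [hprod, LinearEquiv.mul_apply, affineReflection_self, map_neg] at this
    exact this
  obtain ⟨l', h1, h2, h3⟩ := exists_shorter_list hl' hs hneg
  rw [hprod, ← h3] at h ⊢
  exact ih l'.length (by rw [← hn]; simp; omega) l' h1 h rfl

/-- When `N(w) = N(w')`, the element `w'⁻¹ w` preserves `Φ⁺`: for positive `x`, whichever of `w x`,
`-w x` is positive lies in both inversion sets or in neither. -/
theorem inversionSet_injective : Function.Injective (inversionSet (P := P) b) := by
  intro w w' hN
  have hmem : w'.1⁻¹ * w.1 ∈ affineWeylGroup P := mul_mem (inv_mem w'.2) w.2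
  have key : w'.1⁻¹ * w.1 = 1 := by
    refine eq_one_of_preserves_affinePos b hmem fun x hx ↦ ?_
    have hR := affineWeylGroup_apply_mem b hmem (.inl hx)
    refine (mem_affinePos_iff b).2 ⟨hR, lt_of_le_of_ne' ?_ (affineHeight_ne_zero b hR)⟩
    have hx' := ((mem_affinePos_iff b).1 hx).2
    have hinv : w.1⁻¹ (w.1 x) = x := w.1.symm_apply_apply x
    rw [LinearEquiv.mul_apply]
    rcases mem_affinePos_or_neg b (affineWeylGroup_apply_mem b w.2 (.inl hx)) with h | h
    · by_contra! hneg
      have h1 := (mem_inversionSet_iff b w').2 ⟨h, hneg⟩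
      rw [← hN, mem_inversionSet_iff, hinv] at h1
      linarith [h1.2]
    · have h1 := (mem_inversionSet_iff b w).2 ⟨h, by rw [map_neg, hinv, map_neg]; linarith⟩
      rw [hN, mem_inversionSet_iff, map_neg, map_neg] at h1
      linarith [h1.2]
  exact Subtype.ext (inv_mul_eq_one.1 key).symm

end Simple

/-! ### Finite biclosed sets are inversion sets. -/

section Biclosed

variable {ι M N : Type*} [AddCommGroup M] [Module ℝ M] [AddCommGroup N] [Module ℝ N]
  {P : RootPairing ι ℝ M N}

/-- A set of positive real affine roots is biclosed if it is closed under sums and its complement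
in the set of all positive roots, real and imaginary, is closed under sums. -/
structure IsBiclosed (b : P.Base) (S : Set (M × ℝ)) : Prop where
  subset : S ⊆ affinePos b
  add_mem : ∀ x ∈ S, ∀ y ∈ S, x + y ∈ affineRoots b → x + y ∈ S
  mem_or_mem : ∀ x ∈ affinePos b, ∀ y ∈ affinePos b, x + y ∈ S → x ∈ S ∨ y ∈ S
  mem_of_add_delta : ∀ x ∈ affinePos b, x + delta M ∈ S → x ∈ S
  add_ne_delta : ∀ x ∈ S, ∀ y ∈ S, x + y ≠ delta M

variable [P.IsRootSystem] [Finite ι] {b : P.Base}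

/-- Descent on height: a non-simple element of `S` splits as `y + z` or `y + δ`, and coclosedness
puts a lower root in `S`. -/
theorem IsBiclosed.exists_isSimpleRoot {S : Set (M × ℝ)} (hS : IsBiclosed b S)
    (hne : S.Nonempty) : ∃ i k, IsSimpleRoot b (affineRoot P i k) ∧ affineRoot P i k ∈ S := by
  by_contra! hcon
  obtain ⟨x, hx⟩ := hne
  refine affinePos_induction b (p := fun x ↦ x ∉ S) (fun x hx ih hxS ↦ ?_) (hS.subset hx) hx
  by_cases hs : IsSimpleRoot b x
  · obtain ⟨i, k, rfl⟩ := affinePos_subset_range b hx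
    exact hcon i k hs hxS
  have hdec : (∃ y ∈ affinePos b, ∃ z ∈ affinePos b, x = y + z) ∨
      ∃ y ∈ affinePos b, x = y + delta M := by
    by_contra! hc
    exact hs ⟨hx, hc.1, hc.2⟩
  rcases hdec with ⟨y, hy, z, hz, rfl⟩ | ⟨y, hy, rfl⟩
  · have hy' := ((mem_affinePos_iff b).1 hy).2
    have hz' := ((mem_affinePos_iff b).1 hz).2
    rcases hS.mem_or_mem y hy z hz hxS with h | h
    · exact ih y hy (by rw [map_add]; linarith) h
    · exact ih z hz (by rw [map_add]; linarith) h
  · exact ih y hy (by rw [map_add]; linarith [affineHeight_delta_pos b])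
      (hS.mem_of_add_delta y hy hxS)

variable [P.IsCrystallographic] [P.IsReduced]

/-- The reflection permutes the positive roots other than `a` and fixes `δ`, so each condition
transports directly except when a root involved is `a` itself, sent to `-a`. -/
theorem IsBiclosed.image_reflection {S : Set (M × ℝ)} (hS : IsBiclosed b S) {i : ι} {k : ℤ}
    (ha : IsSimpleRoot b (affineRoot P i k)) (haS : affineRoot P i k ∈ S) :
    IsBiclosed b (affineReflection P i k '' (S \ {affineRoot P i k})) := by
  set a := affineRoot P i k
  set s := affineReflection P i k
  have hss (x : M × ℝ) : s (s x) = x := affineReflection_affineReflection i k x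
  have hsa : s a = -a := affineReflection_self i k
  have hsR {x : M × ℝ} (hx : x ∈ affineRoots b) : s x ∈ affineRoots b :=
    affineWeylGroup_apply_mem b (affineReflection_mem i k) hx
  have hsδ : s (delta M) = delta M := affineReflection_delta i k
  have ha0 : affineHeight b a > 0 := ((mem_affinePos_iff b).1 ha.mem).2
  have hmem {x : M × ℝ} : x ∈ s '' (S \ {a}) ↔ s x ∈ S ∧ s x ≠ a := by
    constructor
    · rintro ⟨y, hy, rfl⟩
      rw [hss]
      exact hy
    · exact fun h ↦ ⟨s x, h, hss x⟩
  have hne {x : M × ℝ} (hx : x ∈ affinePos b) : s x ≠ a := by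
    intro h
    have : x = -a := by rw [← hsa, ← h, hss]
    rw [this] at hx
    exact not_neg_mem_affinePos ha.mem hx
  have hpos {x : M × ℝ} (hx : x ∈ S) (hxa : x ≠ a) : s x ∈ affinePos b :=
    ha.reflection_mem (hS.subset hx) hxa
  refine ⟨?_, ?_, ?_, ?_, ?_⟩
  · rintro _ ⟨x, hx, rfl⟩
    exact hpos hx.1 hx.2
  · simp only [hmem]
    rintro x ⟨hx, hxa⟩ y ⟨hy, hya⟩ hxy
    have hxy' := hsR hxy
    rw [map_add] at hxy' ⊢
    exact ⟨hS.add_mem _ hx _ hy hxy', (ha.ne_add _ (hS.subset hx) _ (hS.subset hy)).symm⟩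
  · simp only [hmem]
    rintro x hx y hy ⟨hxy, hxya⟩
    rw [map_add] at hxy hxya
    have aux {x y : M × ℝ} (hx : x = a) (hy : y ∈ affinePos b) (hxy : s x + s y ∈ S) :
        s y ∈ S := by
      have e : s y = (s x + s y) + a := by rw [hx, hsa]; abel
      rw [e]
      exact hS.add_mem _ hxy _ haS (e ▸ hsR (.inl hy))
    by_cases h1 : x = a
    · exact .inr ⟨aux h1 hy hxy, hne hy⟩
    by_cases h2 : y = a
    · exact .inl ⟨aux h2 hx (by rwa [add_comm]), hne hx⟩
    exact (hS.mem_or_mem _ (ha.reflection_mem hx h1) _ (ha.reflection_mem hy h2) hxy).imp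
      (fun h ↦ ⟨h, hne hx⟩) (fun h ↦ ⟨h, hne hy⟩)
  · simp only [hmem]
    rintro x hx ⟨h, -⟩
    rw [map_add, hsδ] at h
    refine ⟨?_, hne hx⟩
    -- For `x = a` the hypothesis says `δ - a ∈ S`; together with `a ∈ S` this is what
    -- `add_ne_delta` forbids.
    by_cases h1 : x = a
    · exfalso
      rw [h1, hsa] at h
      exact hS.add_ne_delta _ h _ haS (by abel)
    · exact hS.mem_of_add_delta _ (ha.reflection_mem hx h1) h
  · simp only [hmem]
    rintro x ⟨hx, -⟩ y ⟨hy, -⟩ h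
    refine hS.add_ne_delta _ hx _ hy ?_
    rw [← map_add, h, hsδ]

/-- A finite biclosed set is the inversion set of an element of the affine Weyl group. -/
theorem IsBiclosed.exists_inversionSet_eq {S : Set (M × ℝ)} (hS : IsBiclosed b S)
    (hfin : S.Finite) : ∃ w : affineWeylGroup P, inversionSet b w = S := by
  induction hn : S.ncard using Nat.strong_induction_on generalizing S with
  | _ n ih =>
  rcases S.eq_empty_or_nonempty with rfl | hne
  · refine ⟨1, eq_empty_of_forall_notMem fun x hx ↦ ?_⟩
    rw [mem_inversionSet_iff, mem_affinePos_iff] at hx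
    exact lt_asymm hx.1.2 (by simpa using hx.2)
  obtain ⟨i, k, ha, haS⟩ := hS.exists_isSimpleRoot hne
  have hlt : (affineReflection P i k '' (S \ {affineRoot P i k})).ncard < n := by
    rw [ncard_image_of_injective _ (affineReflection P i k).injective, ← hn]
    exact ncard_sdiff_singleton_lt_of_mem haS hfin
  obtain ⟨w, hw⟩ := ih _ hlt (hS.image_reflection ha haS) (hfin.sdiff.image _) rfl
  -- Here `N(s w) = {a} ∪ s(N(w))`, as `a ∉ N(w)`; and `s(N(w)) = S \ {a}`.
  refine ⟨⟨affineReflection P i k, affineReflection_mem i k⟩ * w, ?_⟩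
  have hinv (x : M × ℝ) : (affineReflection P i k * w.1)⁻¹ x =
      w.1⁻¹ (affineReflection P i k x) := by
    rw [mul_inv_rev, inv_eq_of_mul_eq_one_left (affineReflection_mul_self i k)]
    rfl
  ext x
  rw [mem_inversionSet_iff]
  change _ ∧ affineHeight b ((affineReflection P i k * w.1)⁻¹ x) < 0 ↔ _
  rw [hinv]
  by_cases hxa : x = affineRoot P i k
  · subst hxa
    refine iff_of_true ⟨ha.mem, ?_⟩ haS
    have h1 : affineRoot P i k ∉ inversionSet b w := by
      rw [hw]
      rintro ⟨y, hy, hya⟩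
      refine not_neg_mem_affinePos ha.mem ?_
      rw [← affineReflection_self, ← hya, affineReflection_affineReflection]
      exact hS.subset hy.1
    rw [mem_inversionSet_iff, not_and, not_lt] at h1
    have h2 := affineHeight_ne_zero b (affineWeylGroup_apply_mem b (inv_mem w.2) (.inl ha.mem))
    rw [affineReflection_self, map_neg, map_neg, neg_lt_zero]
    exact lt_of_le_of_ne' (h1 ha.mem) h2
  · constructor
    · rintro ⟨hx, h⟩
      have h1 := (mem_inversionSet_iff b w).2 ⟨ha.reflection_mem hx hxa, h⟩
      rw [hw] at h1
      obtain ⟨y, hy, hyx⟩ := h1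
      exact (affineReflection P i k).injective hyx ▸ hy.1
    · intro hx
      have h1 : affineReflection P i k x ∈ inversionSet b w := by
        rw [hw]
        exact ⟨x, ⟨hx, hxa⟩, rfl⟩
      exact ⟨hS.subset hx, ((mem_inversionSet_iff b w).1 h1).2⟩

end Biclosed

/-! ### Smallness of the roots `δ - α`. -/

section Small

variable {ι M N : Type*} [AddCommGroup M] [Module ℝ M] [AddCommGroup N] [Module ℝ N]
  {P : RootPairing ι ℝ M N}

theorem delta_sub_mem_affinePos (b : P.Base) {α : M} (hα : α ∈ finitePos b) :
    delta M - emb α ∈ affinePos b :=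
  .inr ⟨α, hα, 1, le_rfl, by simp [emb, delta]⟩

theorem exists_form_eq_two_eq_zero [P.IsReduced] {i j : ι} (h1 : j ≠ i) (h2 : P.root j ≠ -P.root i) :
    ∃ g : M →ₗ[ℝ] ℝ, g (P.root i) = 2 ∧ g (P.root j) = 0 := by
  have hli := RootPairing.IsReduced.linearIndependent P h1.symm
    (fun h ↦ h2 (by rw [h, neg_neg]))
  obtain ⟨g, hg⟩ := ((Module.Basis.span hli).constr ℝ ![(2 : ℝ), 0]).exists_extend
  have key (t : Fin 2) : g (![P.root i, P.root j] t) = ![(2 : ℝ), 0] t := by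
    rw [← (Module.Basis.span hli).constr_basis ℝ ![(2 : ℝ), 0] t, ← hg, LinearMap.comp_apply,
      Submodule.subtype_apply, Module.Basis.span_apply]
  exact ⟨g, key 0, key 1⟩

variable [P.IsRootSystem] [Finite ι]

theorem finite_affinePos_lt (b : P.Base) (g : (M × ℝ) →ₗ[ℝ] ℝ) (hg : 0 < g (delta M)) :
    {x ∈ affinePos b | g x < 0}.Finite := by
  have hbd : BddBelow (range fun i ↦ g (emb (P.root i))) := (finite_range _).bddBelow
  obtain ⟨c, hc⟩ := hbd
  -- As `c` bounds `g` below on the finite roots, `g (α + kδ) < 0` forces `k < -c / g δ`.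
  obtain ⟨n, hn⟩ := exists_nat_gt (-c / g (delta M))
  have hfin : ((fun p : ι × ℤ ↦ affineRoot P p.1 p.2) '' (univ ×ˢ Icc (0 : ℤ) (n : ℤ))).Finite :=
    (finite_univ.prod (finite_Icc (0 : ℤ) (n : ℤ))).image _
  refine hfin.subset ?_
  rintro x ⟨hx, hgx⟩
  obtain ⟨i, k, rfl⟩ := affinePos_subset_range b hx
  refine ⟨(i, k), ⟨mem_univ _, ?_, ?_⟩, rfl⟩
  · have := (affineHeight_pos_iff b i k).1 ((mem_affinePos_iff b).1 hx).2
    change 0 ≤ k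
    omega
  · rw [affineRoot_eq, map_add, map_smul, smul_eq_mul] at hgx
    have h1 : c ≤ g (emb (P.root i)) := hc (mem_range_self i)
    rw [div_lt_iff₀ hg] at hn
    have : (k : ℝ) < n := by
      by_contra! h
      nlinarith
    change k ≤ n
    exact_mod_cast this.le

theorem isBiclosed_affinePos_lt (b : P.Base) (g : (M × ℝ) →ₗ[ℝ] ℝ) (hg : 0 < g (delta M)) :
    IsBiclosed b {x ∈ affinePos b | g x < 0} where
  subset x hx := hx.1
  add_mem x hx y hy hxy :=
    ⟨add_mem_affinePos b hx.1 hy.1 hxy, by rw [map_add]; linarith [hx.2, hy.2]⟩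
  mem_or_mem x hx y hy h := by
    by_contra! hcon
    have h1 := not_lt.1 fun h' ↦ hcon.1 ⟨hx, h'⟩
    have h2 := not_lt.1 fun h' ↦ hcon.2 ⟨hy, h'⟩
    have h3 := h.2
    rw [map_add] at h3
    linarith
  mem_of_add_delta x hx h := ⟨hx, by have := h.2; rw [map_add] at this; linarith⟩
  add_ne_delta x hx y hy h := by
    rw [← h, map_add] at hg
    linarith [hx.2, hy.2]

variable [P.IsCrystallographic] [P.IsReduced]

/-- The affine roots `δ - α`, for `α` a positive root of `Φ₀`, are small. -/
theorem delta_sub_mem_smallRoots (b : P.Base) {α : M} (hα : α ∈ finitePos b) :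
    delta M - emb α ∈ smallRoots b := by
  refine ⟨delta_sub_mem_affinePos b hα, encard_eq_zero.2 <| eq_empty_of_forall_notMem ?_⟩
  rintro γ ⟨hγ, hdom, hne⟩
  obtain ⟨j, k, rfl⟩ := affinePos_subset_range b hγ
  have hk := (affineHeight_pos_iff b j k).1 ((mem_affinePos_iff b).1 hγ).2
  have hk0 : (0 : ℝ) ≤ k := by exact_mod_cast (show 0 ≤ k by omega)
  -- Extended by `δ ↦ 1`, such a `g` takes the value `-1` on `δ - α` and is nonnegative on `γ`, so
  -- its inversion set separates them. The value `2` still leaves `-α + kδ` nonnegative for every `k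
  -- ≥ 2`.
  suffices ∃ g : M →ₗ[ℝ] ℝ, g α = 2 ∧ 0 ≤ g (P.root j) + k by
    obtain ⟨g, hg1, hg2⟩ := this
    have hδ : (g.coprod LinearMap.id) (delta M) = (1 : ℝ) := by simp [delta]
    have hδ' : 0 < (g.coprod LinearMap.id) (delta M) := by rw [hδ]; exact one_pos
    obtain ⟨w, hw⟩ := (isBiclosed_affinePos_lt b _ hδ').exists_inversionSet_eq
      (finite_affinePos_lt b _ hδ')
    have h := hdom w (by
      rw [hw]
      refine ⟨delta_sub_mem_affinePos b hα, ?_⟩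
      rw [map_sub, hδ]
      simp [emb, hg1])
    rw [hw] at h
    have := h.2
    simp [affineRoot] at this
    linarith
  obtain ⟨i, hi, rfl⟩ := hα
  by_cases h1 : j = i
  · refine ⟨P.coroot' i, by simp, ?_⟩
    rw [h1, P.root_coroot'_eq_pairing, P.pairing_same]
    linarith
  by_cases h2 : P.root j = -P.root i
  · refine ⟨P.coroot' i, by simp, ?_⟩
    rw [h2, map_neg, P.root_coroot'_eq_pairing, P.pairing_same]
    have hj : ¬ b.IsPos j := by
      rw [(P.root_eq_neg_iff).1 h2]
      exact fun h ↦ (RootPairing.Base.IsPos.neg_iff_not b i).1 h hi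
    have hk1 : k ≠ 1 := by
      rintro rfl
      exact hne (by simp [affineRoot, delta, emb, h2])
    have : (2 : ℝ) ≤ k := by
      have h3 : 1 ≤ k := hk.resolve_right fun h ↦ hj h.2
      exact_mod_cast (show 2 ≤ k by omega)
    linarith
  · obtain ⟨g, hg1, hg2⟩ := exists_form_eq_two_eq_zero h1 h2
    exact ⟨g, hg1, by rw [hg2]; linarith⟩

end Small

/-! ### The set `L_Ψ`: biclosedness, finiteness and the cone formula. -/

section CelliniPapi

variable {ι M N : Type*} [AddCommGroup M] [Module ℝ M] [AddCommGroup N] [Module ℝ N]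
  {P : RootPairing ι ℝ M N}

theorem nonpos_of_mem_hull {E : Type*} [AddCommGroup E] [Module ℝ E] {X : Set E} (g : E →ₗ[ℝ] ℝ)
    (h : ∀ x ∈ X, g x ≤ 0) {x : E} (hx : x ∈ PointedCone.hull ℝ X) : g x ≤ 0 := by
  induction hx using Submodule.span_induction with
  | mem x hx => exact h x hx
  | zero => simp
  | add x y _ _ hx hy => rw [map_add]; linarith
  | smul c x _ hx =>
    rw [show c • x = (c : ℝ) • x from rfl, map_smul, smul_eq_mul]
    exact mul_nonpos_of_nonneg_of_nonpos c.2 hx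

theorem coneRoots_mono (b : P.Base) {X Y : Set (M × ℝ)} (h : X ⊆ Y) :
    coneRoots b X ⊆ coneRoots b Y :=
  fun _ hx ↦ ⟨Submodule.span_mono h hx.1, hx.2⟩

theorem deltaSub_subset_celliniPapiSet (b : P.Base) (Ψ : Set M) :
    deltaSub Ψ ⊆ celliniPapiSet b Ψ := by
  rintro _ ⟨α, hα, rfl⟩
  exact ⟨0, α, hα, by simp⟩

theorem mem_hull_deltaSub {b : P.Base} {Ψ : Set M} {n : ℕ} {β : M} (hβ : β ∈ rootPower b Ψ n) :
    ((n + 1 : ℕ) : ℝ) • delta M - emb β ∈ PointedCone.hull ℝ (deltaSub Ψ) := by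
  induction n generalizing β with
  | zero => exact Submodule.subset_span ⟨β, hβ, by simp⟩
  | succ n ih =>
    obtain ⟨-, x, hx, y, hy, rfl⟩ := hβ
    have e : ((n + 1 + 1 : ℕ) : ℝ) • delta M - emb (x + y) =
        (((n + 1 : ℕ) : ℝ) • delta M - emb x) + (delta M - emb y) := by
      ext
      · simp [emb, delta]; abel
      · simp [emb, delta]
    rw [e]
    exact add_mem (ih hx) (Submodule.subset_span ⟨y, hy, rfl⟩)

theorem affineRoot_mem_celliniPapiSet {b : P.Base} {Ψ : Set M} {i : ι} {k : ℤ} {n : ℕ}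
    (hk : k = n + 1) (h : -P.root i ∈ rootPower b Ψ n) :
    affineRoot P i k ∈ celliniPapiSet b Ψ :=
  ⟨n, _, h, by ext <;> simp [affineRoot, emb, delta, hk]⟩

theorem exists_of_mem_celliniPapiSet {b : P.Base} {Ψ : Set M} {x : M × ℝ}
    (hx : x ∈ celliniPapiSet b Ψ) : ∃ n : ℕ, x.2 = n + 1 ∧ -x.1 ∈ rootPower b Ψ n := by
  obtain ⟨n, β, hβ, rfl⟩ := hx
  exact ⟨n, by simp [emb, delta], by simpa [emb, delta] using hβ⟩

variable [P.IsRootSystem] [Finite ι] [P.IsCrystallographic] {b : P.Base} {Ψ : Set M}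

/-- Membership in `N(w)` amounts to two linear inequalities on `Φ`, which pass to cones in weak
form; they become strict again because `affineHeight` vanishes on no root. -/
theorem coneRoots_subset_inversionSet (w : affineWeylGroup P) {X : Set (M × ℝ)}
    (hX : X ⊆ inversionSet b w) : coneRoots b X ⊆ inversionSet b w := by
  rintro x ⟨hx, hxR⟩
  have h1 : (-affineHeight b) x ≤ 0 := nonpos_of_mem_hull _ (fun y hy ↦ by
    have := ((mem_affinePos_iff b).1 (hX hy).1).2
    simpa using this.le) hx
  have h2 : (affineHeight b ∘ₗ (w.1⁻¹).toLinearMap) x ≤ 0 := nonpos_of_mem_hull _ (fun y hy ↦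
    ((mem_inversionSet_iff b w).1 (hX hy)).2.le) hx
  refine (mem_inversionSet_iff b w).2 ⟨(mem_affinePos_iff b).2 ⟨hxR, ?_⟩, ?_⟩
  · exact lt_of_le_of_ne' (by simpa using h1) (affineHeight_ne_zero b hxR)
  · exact lt_of_le_of_ne h2
      (affineHeight_ne_zero b (affineWeylGroup_apply_mem b (inv_mem w.2) hxR))

theorem IsUpper.isBiclosed_celliniPapiSet (h : IsUpper b Ψ) :
    IsBiclosed b (celliniPapiSet b Ψ) where
  subset := by
    rintro _ ⟨n, β, hβ, rfl⟩
    refine .inr ⟨β, h.rootPower_subset n hβ, n + 1, by omega, ?_⟩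
    ext <;> simp [emb, delta]
  add_mem := by
    rintro _ ⟨m, β, hβ, rfl⟩ _ ⟨n, γ, hγ, rfl⟩ hR
    obtain ⟨i, k, hik⟩ := (mem_affineRoots_iff b).1 hR
    have h1 := congrArg Prod.fst hik
    simp only [emb, delta, affineRoot, Prod.fst_add, Prod.fst_sub, Prod.smul_fst, smul_zero,
      zero_sub] at h1
    have hβγ : β + γ ∈ range P.root := by
      have : β + γ = -P.root i := by rw [← h1]; abel
      rw [this]
      exact neg_mem_range_root (mem_range_self i)
    refine ⟨m + n + 1, β + γ, h.add_mem_rootPower hβ hγ hβγ, ?_⟩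
    ext
    · simp [emb, delta]; abel
    · simp [emb, delta]; ring
  mem_or_mem x hx y hy hxy := by
    -- A summand with positive finite part can be dropped: adding that part to an element of the
    -- power keeps it there, and the level `k` does not exceed the original one, so antitonicity
    -- applies. If both finite parts are negative, `mem_or_mem_rootPower` decides.
    have aux {i j : ι} {k l : ℤ} (hx : affineRoot P i k ∈ affinePos b)
        (hy : affineRoot P j l ∈ affinePos b) (hj : P.root j ∈ finitePos b)
        (hxy : affineRoot P i k + affineRoot P j l ∈ celliniPapiSet b Ψ) :
        affineRoot P i k ∈ celliniPapiSet b Ψ := by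
      obtain ⟨n, hn, hβ⟩ := exists_of_mem_celliniPapiSet hxy
      have hn' : k + l = n + 1 := by simp [affineRoot] at hn; exact_mod_cast hn
      have hl := (affineHeight_pos_iff b j l).1 ((mem_affinePos_iff b).1 hy).2
      have hk := (affineHeight_pos_iff b i k).1 ((mem_affinePos_iff b).1 hx).2
      have e : -(affineRoot P i k + affineRoot P j l).1 + P.root j = -P.root i := by
        simp [affineRoot]
      have h1 := (h.rootPower n).add_mem _ hβ _ hj
        (e ▸ neg_mem_range_root (mem_range_self i))
      rw [e] at h1
      have hi : ¬ b.IsPos i := by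
        intro hi
        have h2 := ((mem_finitePos_iff b).1 (h.rootPower_subset n h1)).2
        have h3 := ((mem_finitePos_iff b).1 ⟨i, hi, rfl⟩).2
        rw [map_neg] at h2
        linarith
      have hk1 : 1 ≤ k := hk.resolve_right fun h ↦ hi h.2
      exact affineRoot_mem_celliniPapiSet (n := (k - 1).toNat) (by omega)
        (h.rootPower_antitone (by omega) h1)
    obtain ⟨i, k, rfl⟩ := affinePos_subset_range b hx
    obtain ⟨j, l, rfl⟩ := affinePos_subset_range b hy
    rcases mem_finitePos_or_neg b (mem_range_self (f := P.root) j) with hj | hj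
    · exact .inl (aux hx hy hj hxy)
    rcases mem_finitePos_or_neg b (mem_range_self (f := P.root) i) with hi | hi
    · exact .inr (aux hy hx hi (by rwa [add_comm]))
    have pos {i : ι} {k : ℤ} (hx : affineRoot P i k ∈ affinePos b)
        (hi : -P.root i ∈ finitePos b) : 1 ≤ k := by
      refine ((affineHeight_pos_iff b i k).1 ((mem_affinePos_iff b).1 hx).2).resolve_right ?_
      rintro ⟨-, hpos⟩
      have h2 := ((mem_finitePos_iff b).1 hi).2
      have h3 := ((mem_finitePos_iff b).1 ⟨i, hpos, rfl⟩).2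
      rw [map_neg] at h2
      linarith
    have hk := pos hx hi
    have hl := pos hy hj
    obtain ⟨n, hn, hβ⟩ := exists_of_mem_celliniPapiSet hxy
    have hn' : k + l = n + 1 := by simp [affineRoot] at hn; exact_mod_cast hn
    have e : -(affineRoot P i k + affineRoot P j l).1 = -P.root i + -P.root j := by
      simp [affineRoot]; abel
    rw [e, show n = (k - 1).toNat + (l - 1).toNat + 1 by omega] at hβ
    exact (h.mem_or_mem_rootPower hi hj hβ).imp
      (affineRoot_mem_celliniPapiSet (by omega)) (affineRoot_mem_celliniPapiSet (by omega))
  mem_of_add_delta x hx hxδ := by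
    obtain ⟨i, k, rfl⟩ := affinePos_subset_range b hx
    obtain ⟨n, hn, hβ⟩ := exists_of_mem_celliniPapiSet hxδ
    have hn' : k = n := by simp [affineRoot, delta] at hn; exact_mod_cast hn
    have e : -(affineRoot P i k + delta M).1 = -P.root i := by simp [affineRoot, delta]
    rw [e] at hβ
    have hk : 1 ≤ k := by
      refine ((affineHeight_pos_iff b i k).1 ((mem_affinePos_iff b).1 hx).2).resolve_right ?_
      rintro ⟨-, hpos⟩
      have h2 := ((mem_finitePos_iff b).1 (h.rootPower_subset n hβ)).2
      have h3 := ((mem_finitePos_iff b).1 ⟨i, hpos, rfl⟩).2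
      rw [map_neg] at h2
      linarith
    exact affineRoot_mem_celliniPapiSet (n := n - 1) (by omega)
      (h.rootPower_antitone (by omega) hβ)
  add_ne_delta x hx y hy hxy := by
    obtain ⟨m, -, hm⟩ := exists_of_mem_celliniPapiSet hx
    obtain ⟨n, -, hn⟩ := exists_of_mem_celliniPapiSet hy
    have h1 := ((mem_finitePos_iff b).1 (h.rootPower_subset m hm)).2
    have h2 := ((mem_finitePos_iff b).1 (h.rootPower_subset n hn)).2
    have h3 := congrArg (fun z ↦ heightForm b z.1) hxy
    simp only [delta, Prod.fst_add, map_add, map_zero, map_neg] at h1 h2 h3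
    linarith

theorem IsUpper.finite_celliniPapiSet (h : IsUpper b Ψ) : (celliniPapiSet b Ψ).Finite := by
  -- Elements of `Ψ^k` have height at least `k`, so this form is at most `k/2 - k < 0` on `kδ - β`.
  refine (finite_affinePos_lt b ((heightForm b).coprod ((1 / 2 : ℝ) • LinearMap.id))
    (by simp [delta])).subset fun x hx ↦ ⟨h.isBiclosed_celliniPapiSet.subset hx, ?_⟩
  obtain ⟨n, β, hβ, rfl⟩ := hx
  have h1 := h.natCast_lt_heightForm hβ
  obtain ⟨i, -, rfl⟩ := h.rootPower_subset n hβ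
  rw [heightForm_root] at h1
  have h2 : (n : ℝ) + 1 ≤ b.height i := by exact_mod_cast h1
  simp [emb, delta, heightForm_root]
  linarith

variable [P.IsReduced]

/-- The Cellini–Papi set of an upper set of positive roots is the inversion set of a unique element
of the affine Weyl group, this element is low, and its inversion set is spanned by the small roots
`δ - α`. -/
theorem IsUpper.existsUnique_inversionSet_eq (h : IsUpper b Ψ) :
    (∃! w : affineWeylGroup P, inversionSet b w = celliniPapiSet b Ψ) ∧
    deltaSub Ψ ⊆ smallRoots b ∧
    ∀ w : affineWeylGroup P, inversionSet b w = celliniPapiSet b Ψ →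
      inversionSet b w = coneRoots b (deltaSub Ψ) ∧ IsLow b w := by
  have hsmall : deltaSub Ψ ⊆ smallRoots b := by
    rintro _ ⟨α, hα, rfl⟩
    exact delta_sub_mem_smallRoots b (h.subset hα)
  refine ⟨?_, hsmall, fun w hw ↦ ?_⟩
  · obtain ⟨w, hw⟩ :=
      h.isBiclosed_celliniPapiSet.exists_inversionSet_eq h.finite_celliniPapiSet
    exact ⟨w, hw, fun w' hw' ↦ inversionSet_injective (hw'.trans hw.symm)⟩
  · have hsub : deltaSub Ψ ⊆ inversionSet b w := hw ▸ deltaSub_subset_celliniPapiSet b Ψ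
    have hle : inversionSet b w ⊆ coneRoots b (deltaSub Ψ) := by
      intro x hx
      refine ⟨?_, .inl hx.1⟩
      rw [hw] at hx
      obtain ⟨n, β, hβ, rfl⟩ := hx
      exact mem_hull_deltaSub hβ
    -- Lowness is the chain `N(w) ⊆ cone(δ - Ψ) ⊆ cone(Σ ∩ N(w)) ⊆ N(w)`.
    exact ⟨hle.antisymm (coneRoots_subset_inversionSet w hsub),
      (hle.trans (coneRoots_mono b (subset_inter hsmall hsub))).antisymm
        (coneRoots_subset_inversionSet w inter_subset_right)⟩

end CelliniPapi

/-! ### Brackets of root spaces via `sl₂`-theory. -/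

section RootSpaces

open LieAlgebra LieAlgebra.IsKilling LieModule

variable {K L : Type*} [Field K] [CharZero K] [LieRing L] [LieAlgebra K L]
  [IsKilling K L] [FiniteDimensional K L]
  {H : LieSubalgebra K L} [H.IsCartanSubalgebra] [IsTriangularizable K H L]

/-- `L_(α+β) = [L_α, L_β]`, elementwise, if `α` and `α + β` are roots and `β` is a weight. -/
theorem exists_lie_eq_of_mem_rootSpace_add {α β γ : Weight K H L} (hα : α.IsNonZero)
    (hγ : γ.IsNonZero) (hsum : (γ : H → K) = α + β) {y : L}
    (hy : y ∈ rootSpace H γ) :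
    ∃ e ∈ rootSpace H α, ∃ x ∈ rootSpace H β, ⁅e, x⁆ = y := by
  obtain ⟨z, hz, hz0⟩ := (chainTop α β).exists_ne_zero
  obtain ⟨h, e, f, isSl2, he, hf⟩ := exists_isSl2Triple_of_weight_isNonZero hα
  obtain rfl := isSl2.h_eq_coroot hα he hf
  have prim : isSl2.HasPrimitiveVectorWith z (chainLength α β : K) :=
    have := lie_mem_genWeightSpace_of_mem_genWeightSpace he hz
    ⟨hz0, (chainLength_smul _ _ hz).symm, by rwa [genWeightSpace_add_chainTop _ _ hα] at this⟩
  have htop : 1 ≤ chainTopCoeff α β := by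
    have := (rootSpace_zsmul_add_ne_bot_iff α β hα 1).1
      (by rw [one_smul, ← hsum]; exact γ.genWeightSpace_ne_bot)
    exact_mod_cast this.1
  -- In the `α`-string through `β`, `γ` lies `p` steps below the top and `β` lies `p + 1` steps
  -- below. So `e` sends `f^(p+1) z` to a nonzero multiple of `f^p z`, which spans the
  -- one-dimensional root space of `γ`.
  obtain ⟨p, hp⟩ := Nat.exists_eq_add_of_le' htop
  have hlen : p + 1 ≤ chainLength α β := hp ▸ chainTopCoeff_le_chainLength α β
  have hmem (n : ℕ) : (toEnd K L L f ^ n) z ∈ rootSpace H (n • (-α : H → K) + chainTop α β) :=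
    toEnd_pow_apply_mem hf hz n
  have e1 : ((p + 1) • (-α : H → K) + chainTop α β : H → K) = β := by
    rw [coe_chainTop', hp, smul_neg, neg_add_cancel_left]
  have e0 : (p • (-α : H → K) + chainTop α β : H → K) = γ := by
    rw [coe_chainTop', hp, hsum, succ_nsmul, smul_neg]
    abel
  have h1 := hmem (p + 1)
  have h0 := hmem p
  rw [e1] at h1
  rw [e0] at h0
  have hne := prim.pow_toEnd_f_ne_zero_of_eq_nat rfl (show p ≤ chainLength α β by omega)
  have hlie := prim.lie_e_pow_succ_toEnd_f p
  obtain ⟨c, hc⟩ : ∃ c : K, c • (toEnd K L L f ^ p) z = y := by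
    simpa using (finrank_eq_one_iff_of_nonzero' ⟨_, h0⟩ (by simpa using hne)).mp
      (finrank_rootSpace_eq_one _ hγ) ⟨_, hy⟩
  have hd : ((p + 1 : K) * (chainLength α β - p)) ≠ 0 := by
    refine mul_ne_zero (Nat.cast_add_one_ne_zero p) (sub_ne_zero.2 ?_)
    exact_mod_cast (show chainLength α β ≠ p by omega)
  refine ⟨e, he, (c * ((p + 1 : K) * (chainLength α β - p))⁻¹) • (toEnd K L L f ^ (p + 1)) z,
    Submodule.smul_mem _ _ h1, ?_⟩
  rw [lie_smul, hlie, smul_smul, mul_assoc, inv_mul_cancel₀ hd, mul_one, hc]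

end RootSpaces

/-! ### The real root system and the roots of an ideal. -/

section Ideals

open LieAlgebra LieAlgebra.IsKilling

variable {L : Type*} [LieRing L] [LieAlgebra ℂ L] [FiniteDimensional ℂ L] [LieAlgebra.IsSimple ℂ L]
  {H : LieSubalgebra ℂ L} [H.IsCartanSubalgebra]

instance isCrystallographic_realRootSystem : (realRootSystem H).IsCrystallographic where
  exists_value i j := by
    obtain ⟨z, hz⟩ := RootPairing.IsValuedIn.exists_value (P := rootSystem H) (S := ℤ) i j
    refine ⟨z, (algebraMap ℝ ℂ).injective ?_⟩
    have := RootPairing.IsValuedIn.trans (rootSystem H) ℝ ℤ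
    rw [(rootSystem H).restrictScalars_pairing ℝ, ← hz]
    simp

instance isReduced_realRootSystem : (realRootSystem H).IsReduced where
  eq_or_eq_neg i j h := by
    have h' : ¬ LinearIndependent ℂ ![(rootSystem H).root i, (rootSystem H).root j] := by
      refine fun hli ↦ h (LinearIndependent.of_comp (Submodule.subtype _) ?_)
      have e : Submodule.subtype _ ∘ ![(realRootSystem H).root i, (realRootSystem H).root j] =
          ![(rootSystem H).root i, (rootSystem H).root j] := by
        funext t
        fin_cases t <;> rfl
      rw [e]
      exact hli.restrict_scalars' ℝ
    exact (RootPairing.IsReduced.eq_or_eq_neg i j h').imp Subtype.ext Subtype.ext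

/-- The roots of an ideal of a Borel subalgebra form an upper set of positive roots. -/
theorem isUpper_idealRoots {B : LieSubalgebra ℂ L} {b : (realRootSystem H).Base}
    (hb : IsBaseOf b B) (J : LieIdeal ℂ B) : IsUpper b (idealRoots b J) where
  subset := by
    rintro _ ⟨α, hα, rfl, -⟩
    exact ⟨α, hα, rfl⟩
  add_mem := by
    rintro _ ⟨α, hα, rfl, hJ⟩ _ ⟨β, hβ, rfl⟩ ⟨γ, hγ⟩
    refine ⟨γ, hα.add hβ hγ, hγ, fun y hy ↦ ?_⟩
    have hsum : (γ.1 : H → ℂ) = β.1 + α.1 := by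
      have h1 : (rootSystem H).root γ = (rootSystem H).root α + (rootSystem H).root β :=
        congrArg Subtype.val hγ
      funext t
      have := LinearMap.congr_fun h1 t
      simpa [add_comm] using this
    -- The left factor is taken in the root space of `β`, inside `B`, and the right one in that of
    -- `α`, inside `J`, so the bracket stays in the ideal.
    obtain ⟨e, he, x, hx, rfl⟩ := exists_lie_eq_of_mem_rootSpace_add
      (LieSubalgebra.isNonZero_coe_root β) (LieSubalgebra.isNonZero_coe_root γ) hsum hy
    obtain ⟨hxB, hxJ⟩ := hJ x hx
    have heB := (hb β).1 hβ e he
    exact ⟨B.lie_mem heB hxB, lie_mem_right ℂ B J ⟨e, heB⟩ ⟨x, hxB⟩ hxJ⟩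

end Ideals

end AffineRoot

theorem mainTheorem1 {L : Type*} [LieRing L] [LieAlgebra ℂ L] [FiniteDimensional ℂ L]
    [LieAlgebra.IsSimple ℂ L] (H : LieSubalgebra ℂ L) [H.IsCartanSubalgebra]
    (B : LieSubalgebra ℂ L) (hB : AffineRoot.IsBorel B) (hHB : H ≤ B)
    (b : (AffineRoot.realRootSystem H).Base) (hb : AffineRoot.IsBaseOf b B)
    (J : LieIdeal ℂ B) (hJ : AffineRoot.IsAdNilpotentIdeal J) :
    (∃! w : AffineRoot.affineWeylGroup (AffineRoot.realRootSystem H),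
      AffineRoot.inversionSet b w =
        AffineRoot.celliniPapiSet b (AffineRoot.idealRoots b J)) ∧
    AffineRoot.deltaSub (AffineRoot.idealRoots b J) ⊆ AffineRoot.smallRoots b ∧
    ∀ w : AffineRoot.affineWeylGroup (AffineRoot.realRootSystem H),
      AffineRoot.inversionSet b w =
        AffineRoot.celliniPapiSet b (AffineRoot.idealRoots b J) →
      AffineRoot.inversionSet b w =
        AffineRoot.coneRoots b (AffineRoot.deltaSub (AffineRoot.idealRoots b J)) ∧
      AffineRoot.IsLow b w := 
  (AffineRoot.isUpper_idealRoots hb J).existsUnique_inversionSet_eq
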